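/- For a Borel probability measure $\mu$ on $\mathbb R$ with finite moments $m_n(\mu)=\int_{\mathbb R}u^n\,\mu(du)$ of all orders, the free cumulants $\kappa_1(\mu),\kappa_2(\mu),\dots$ are the real numbers determined by $m_n(\mu)=\sum_{\pi\in NC(n)}\prod_{B\in\pi}\kappa_{|B|}(\mu)$ for all $n\ge1$, where $NC(n)$ is the set of noncrossing partitions of $\{1,\dots,n\}$. Let $\kappa_3,\kappa_4\in\mathbb R$. The sequence $0,1,\kappa_3,\kappa_4,0,0,\dots$ is the sequence of free cumulants of some probability measure on $\mathbb R$ if and only if $(\kappa_3,\kappa_4)\in D$, where $$D:=\Big\{(x,y)\in\mathbb R^2:\ |x|\le f_1(y),\ -\tfrac1{12}\le y\le\tfrac1{36}\Big\}\cup\Big\{(x,y)\in\mathbb R^2:\ |x|\le f_2(y),\ \tfrac1{36}<y\le\tfrac14\Big\}$$ with $$f_1(y):=\frac1{3\sqrt6}\sqrt{1+\sqrt{1-36y}}\,\Big(2-\sqrt{1-36y}\Big)\quad\text{for } -\tfrac1{12}\le y\le\tfrac1{36},$$ $$f_2(y):=\frac{\sqrt2\,\sqrt[4]{y}}{3\sqrt3}\cdot\frac{\sqrt{1+\sqrt{1-12\sqrt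 y+36y}}\,\Big(2-\sqrt{1-12\sqrt y+36y}\Big)}{\sqrt{1-2\sqrt y}}\quad\text{for } \tfrac1{36}<y<\tfrac14,\qquad f_2\big(\tfrac14\big):=0.$$ In particular, for $\kappa_3\in\mathbb R$, the sequence $0,1,\kappa_3,0,0,\dots$ is the sequence of free cumulants of some probability measure on $\mathbb R$ if and only if $|\kappa_3|\le\frac1{3\sqrt3}$. -/

import Mathlib

open MeasureTheory

/-- A partition `π` of `{0, …, n - 1}` is noncrossing if there are no `a < b < c < d` such that
`a, c` lie in one block of `π` and `b, d` lie in a different block of `π`. -/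
def IsNoncrossing {n : ℕ} (π : Finpartition (Finset.univ : Finset (Fin n))) : Prop :=
  ∀ B ∈ π.parts, ∀ C ∈ π.parts, ∀ a ∈ B, ∀ b ∈ C, ∀ c ∈ B, ∀ d ∈ C,
    a < b → b < c → c < d → B = C

instance {n : ℕ} (π : Finpartition (Finset.univ : Finset (Fin n))) :
    Decidable (IsNoncrossing π) := by
  unfold IsNoncrossing
  infer_instance

/-- The right-hand side `∑_{π ∈ NC(n)} ∏_{B ∈ π} κ_{|B|}` of the free moment-cumulant formula. -/
def ncMoment {R : Type*} [CommSemiring R] (κ : ℕ → R) (n : ℕ) : R :=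
  ∑ π : Finpartition (Finset.univ : Finset (Fin n)) with IsNoncrossing π,
    ∏ B ∈ π.parts, κ B.card

/-- `κ 1, κ 2, κ 3, …` is the sequence of free cumulants of the measure `μ` on the real line:
all moments of `μ` are finite and the free moment-cumulant formula
`m_n(μ) = ∑_{π ∈ NC(n)} ∏_{B ∈ π} κ_{|B|}` holds for all `n ≥ 1`. (The one-block partition
contributes the term `κ n` and every other term involves only `κ 1, …, κ (n - 1)`, so `μ`
determines `κ n` for all `n ≥ 1`. The value `κ 0` plays no role, as blocks are nonempty.) -/
def IsFreeCumulantSeq (κ : ℕ → ℝ) (μ : Measure ℝ) : Prop :=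
  (∀ n : ℕ, Integrable (fun x : ℝ => x ^ n) μ) ∧
    ∀ n : ℕ, 1 ≤ n → ∫ x : ℝ, x ^ n ∂μ = ncMoment κ n

/-- The sequence `κ 1 = 0, κ 2 = 1, κ 3 = x, κ 4 = y` and `κ n = 0` for `n ≥ 5`. -/
def cumulantSeq (x y : ℝ) : ℕ → ℝ
  | 2 => 1
  | 3 => x
  | 4 => y
  | _ => 0

/-- `κ` is the sequence of free cumulants of some Borel probability measure on `ℝ`. -/
def IsRealizable (κ : ℕ → ℝ) : Prop :=
  ∃ μ : Measure ℝ, IsProbabilityMeasure μ ∧ IsFreeCumulantSeq κ μ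

/-- The boundary function for `-1/12 ≤ y ≤ 1/36`. -/
noncomputable def f₁ (y : ℝ) : ℝ :=
  1 / (3 * √6) * √(1 + √(1 - 36 * y)) * (2 - √(1 - 36 * y))

/-- The boundary function for `1/36 < y ≤ 1/4`; its value at `1/4` is `0`. -/
noncomputable def f₂ (y : ℝ) : ℝ :=
  if y = 1 / 4 then 0
  else
    √2 * y ^ (1 / 4 : ℝ) / (3 * √3) *
      (√(1 + √(1 - 12 * √y + 36 * y)) * (2 - √(1 - 12 * √y + 36 * y)) / √(1 - 2 * √y))

/-- The region of the realizable pairs of third and fourth free cumulants. -/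
def regionD : Set (ℝ × ℝ) :=
  {p | |p.1| ≤ f₁ p.2 ∧ -(1 / 12) ≤ p.2 ∧ p.2 ≤ 1 / 36} ∪
    {p | |p.1| ≤ f₂ p.2 ∧ 1 / 36 < p.2 ∧ p.2 ≤ 1 / 4}

/-! Write Φ(z) = 1 + z² + xz³ + yz⁴ and K(z) = Φ(z)/z = 1/z + z + xz² + yz³. Splitting a noncrossing
partition at the second element of its first block shows that the moment series satisfies M = Φ(tM).
Lagrange inversion turns this into (n+1) mₙ = [zⁿ] Φⁿ⁺¹, and for a measure with these cumulants it
says that K inverts the Cauchy transform near infinity. The sign of Im K at a nonreal point z is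
governed by the quartic `curvePoly` in s = 1/|z|, with c the cosine of the argument of z.

Necessity. The moments grow at most geometrically, so a realizing measure has compact support, and
its Cauchy transform G is analytic off the real axis. Outside D there is a nonreal zero z₀ of K'
such that Im K keeps one sign on the whole segment from 0 to z₀ (`exists_critical_modulus`,
`curvePoly_pos_of_ge`). The identity G(K(z)) = z, valid near 0, continues along this segment up to
z₀, where differentiating it is impossible because K'(z₀) = 0 (`deriv_ne_zero_of_ray`). With T =
1/|z₀|², two conditions on z₀ are T² > y and 3T² - T + 3y > 0; their degenerate cases produce f₂ and
f₁.

Sufficiency. On D some circle |z| = 1/s has `curvePoly` ≤ 0 in every direction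
(`exists_curvePoly_nonpos`), and shrinking (x, y) towards 0 makes the inequality strict. Then Im K
vanishes on a C¹ curve z(θ) inside that circle, u = K(z(θ)) is real and monotone, and Stieltjes
inversion suggests the positive density (Im z)/π with respect to u. Integration by parts reduces its
moments to integrals of Im(zᵐ dz), which leave only [zⁿ] Φⁿ⁺¹/(n+1) (`isRealizable_of_strict`).
Points with equality are reached as limits by compactness. -/

/-! ### Noncrossing partitions: splitting at the second element of the first block -/

/-- `P` is a noncrossing partition of the finite set `S`. -/
structure IsNCPart (S : Finset ℕ) (P : Finset (Finset ℕ)) : Prop where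
  nonempty : ∀ B ∈ P, B.Nonempty
  subset : ∀ B ∈ P, ∀ x ∈ B, x ∈ S
  cover : ∀ x ∈ S, ∃ B ∈ P, x ∈ B
  eq_of_mem : ∀ B ∈ P, ∀ C ∈ P, ∀ x ∈ B, x ∈ C → B = C
  noncrossing : ∀ B ∈ P, ∀ C ∈ P, ∀ a ∈ B, ∀ b ∈ C, ∀ c ∈ B, ∀ d ∈ C,
    a < b → b < c → c < d → B = C

open Classical in
/-- The finite set of noncrossing partitions of `S`. -/
noncomputable def ncParts (S : Finset ℕ) : Finset (Finset (Finset ℕ)) :=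
  S.powerset.powerset.filter (IsNCPart S)

theorem mem_ncParts {S : Finset ℕ} {P : Finset (Finset ℕ)} :
    P ∈ ncParts S ↔ IsNCPart S P := by
  classical
  simp only [ncParts, Finset.mem_filter, Finset.mem_powerset, and_iff_right_iff_imp]
  intro h B hB
  exact Finset.mem_powerset.2 fun x hx => h.subset B hB x hx

/-- The weight of a partition in which the block containing `r` counts `j` additional points. -/
def rootedWeight {R : Type*} [CommSemiring R] (κ : ℕ → R) (r j : ℕ) (P : Finset (Finset ℕ)) : R :=
  ∏ B ∈ P, κ (B.card + if r ∈ B then j else 0)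

/-- The sum of the rooted weights of all noncrossing partitions of `S`. -/
noncomputable def rootedSum {R : Type*} [CommSemiring R] (κ : ℕ → R) (r j : ℕ) (S : Finset ℕ) : R :=
  ∑ P ∈ ncParts S, rootedWeight κ r j P

/-- Add the point `a` to the block containing `i`. -/
def attach (a i : ℕ) (B : Finset ℕ) : Finset ℕ := if i ∈ B then insert a B else B

theorem mem_attach {a i x : ℕ} {B : Finset ℕ} :
    x ∈ attach a i B ↔ x ∈ B ∨ (x = a ∧ i ∈ B) := by
  unfold attach; split_ifs with h <;> simp [h, or_comm]

theorem erase_attach {a i : ℕ} {B : Finset ℕ} (h : a ∉ B) : (attach a i B).erase a = B := by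
  unfold attach; split_ifs
  · exact Finset.erase_insert h
  · exact Finset.erase_eq_of_notMem h

/-- The point `i` is the second element of the block of `P` whose first element is `a`. -/
def IsNext (a i : ℕ) (P : Finset (Finset ℕ)) : Prop :=
  ∃ B ∈ P, a ∈ B ∧ i ∈ B ∧ a < i ∧ ∀ k ∈ B, a < k → i ≤ k

/-- If `i` follows `a` in its block, no block can join the points strictly between them to points
beyond. The two pieces are therefore independent, and the partition is recovered by letting `a`
rejoin the block of `i`. -/
theorem IsNCPart.glue {a i b : ℕ} (hai : a < i) (hib : i < b) {Q R : Finset (Finset ℕ)}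
    (hQ : IsNCPart (Finset.Ico (a + 1) i) Q) (hR : IsNCPart (Finset.Ico i b) R) :
    IsNCPart (Finset.Ico a b) (Q ∪ R.image (attach a i)) ∧
      IsNext a i (Q ∪ R.image (attach a i)) := by
  have hQ' : ∀ B ∈ Q, ∀ x ∈ B, a < x ∧ x < i := fun B hB x hx => by
    have := Finset.mem_Ico.1 (hQ.subset B hB x hx); omega
  have hR' : ∀ B ∈ R, ∀ x ∈ B, i ≤ x ∧ x < b := fun B hB x hx =>
    Finset.mem_Ico.1 (hR.subset B hB x hx)
  have hR2 : ∀ B ∈ R, ∀ x ∈ attach a i B, (x = a ∧ i ∈ B) ∨ (x ∈ B ∧ i ≤ x ∧ x < b) := by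
    intro B hB x hx
    rcases mem_attach.1 hx with h | h
    · exact Or.inr ⟨h, hR' B hB x h⟩
    · exact Or.inl h
  obtain ⟨R₀, hR₀, hi₀⟩ := hR.cover i (Finset.mem_Ico.2 ⟨le_rfl, hib⟩)
  refine ⟨⟨?_, ?_, ?_, ?_, ?_⟩, ?_⟩
  · intro B hB0
    rcases Finset.mem_union.1 hB0 with hB | hB1
    · exact hQ.nonempty B hB
    · obtain ⟨C, hC, rfl⟩ := Finset.mem_image.1 hB1
      obtain ⟨x, hx⟩ := hR.nonempty C hC
      exact ⟨x, mem_attach.2 (Or.inl hx)⟩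
  · intro B hB0 x hx
    rw [Finset.mem_Ico]
    rcases Finset.mem_union.1 hB0 with hB | hB1
    · have := hQ' B hB x hx; omega
    · obtain ⟨C, hC, rfl⟩ := Finset.mem_image.1 hB1
      rcases hR2 C hC x hx with h | h <;> omega
  · intro x hx
    rw [Finset.mem_Ico] at hx
    rcases lt_or_ge x i with h | h
    · rcases eq_or_lt_of_le hx.1 with h' | h'
      · exact ⟨attach a i R₀, Finset.mem_union_right _ (Finset.mem_image_of_mem _ hR₀),
          mem_attach.2 (Or.inr ⟨h'.symm, hi₀⟩)⟩
      · obtain ⟨B, hB, hxB⟩ := hQ.cover x (Finset.mem_Ico.2 ⟨h', h⟩)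
        exact ⟨B, Finset.mem_union_left _ hB, hxB⟩
    · obtain ⟨B, hB, hxB⟩ := hR.cover x (Finset.mem_Ico.2 ⟨h, hx.2⟩)
      exact ⟨attach a i B, Finset.mem_union_right _ (Finset.mem_image_of_mem _ hB),
        mem_attach.2 (Or.inl hxB)⟩
  · intro B hB0 C hC0 x hxB hxC
    rcases Finset.mem_union.1 hB0 with hB | hB1 <;> rcases Finset.mem_union.1 hC0 with hC | hC1
    · exact hQ.eq_of_mem B hB C hC x hxB hxC
    · obtain ⟨C, hC, rfl⟩ := Finset.mem_image.1 hC1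
      have := hQ' B hB x hxB
      rcases hR2 C hC x hxC with h | h <;> omega
    · obtain ⟨B, hB, rfl⟩ := Finset.mem_image.1 hB1
      have := hQ' C hC x hxC
      rcases hR2 B hB x hxB with h | h <;> omega
    · obtain ⟨C, hC, rfl⟩ := Finset.mem_image.1 hC1
      obtain ⟨B, hB, rfl⟩ := Finset.mem_image.1 hB1
      congr 1
      rcases hR2 C hC x hxC with h | h <;> rcases hR2 B hB x hxB with h' | h'
      · exact hR.eq_of_mem B hB C hC i h'.2 h.2
      · omega
      · omega
      · exact hR.eq_of_mem B hB C hC x h'.1 h.1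
  · intro B hB0 C hC0 p hp q hq r hr s hs hpq hqr hrs
    rcases Finset.mem_union.1 hB0 with hB | hB1 <;> rcases Finset.mem_union.1 hC0 with hC | hC1
    · exact hQ.noncrossing B hB C hC p hp q hq r hr s hs hpq hqr hrs
    · obtain ⟨C, hC, rfl⟩ := Finset.mem_image.1 hC1
      have := hQ' B hB p hp
      have := hQ' B hB r hr
      rcases hR2 C hC q hq with h | h <;> omega
    · obtain ⟨B, hB, rfl⟩ := Finset.mem_image.1 hB1
      have := hQ' C hC q hq
      have := hQ' C hC s hs
      rcases hR2 B hB r hr with h | h <;> omega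
    · obtain ⟨C, hC, rfl⟩ := Finset.mem_image.1 hC1
      obtain ⟨B, hB, rfl⟩ := Finset.mem_image.1 hB1
      congr 1
      have hr' : r ∈ B := by rcases hR2 B hB r hr with h | h
                             · rcases hR2 B hB p hp with h' | h' <;> omega
                             · exact h.1
      have hq' : q ∈ C := by rcases hR2 C hC q hq with h | h
                             · rcases hR2 B hB p hp with h' | h' <;> omega
                             · exact h.1
      have hs' : s ∈ C := by rcases hR2 C hC s hs with h | h
                             · rcases hR2 B hB p hp with h' | h' <;> omega
                             · exact h.1
      rcases hR2 B hB p hp with h | h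
      · rcases eq_or_lt_of_le (hR' C hC q hq').1 with h' | h'
        · exact hR.eq_of_mem B hB C hC i h.2 (h' ▸ hq')
        · exact hR.noncrossing B hB C hC i h.2 q hq' r hr' s hs' h' hqr hrs
      · exact hR.noncrossing B hB C hC p h.1 q hq' r hr' s hs' hpq hqr hrs
  · refine ⟨attach a i R₀, Finset.mem_union_right _ (Finset.mem_image_of_mem _ hR₀),
      mem_attach.2 (Or.inr ⟨rfl, hi₀⟩), mem_attach.2 (Or.inl hi₀), hai, ?_⟩
    intro k hk hak
    rcases hR2 R₀ hR₀ k hk with h | h <;> omega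

theorem IsNCPart.glue_injective {a i b : ℕ} (hai : a < i) {Q R Q' R' : Finset (Finset ℕ)}
    (hQ : IsNCPart (Finset.Ico (a + 1) i) Q) (hR : IsNCPart (Finset.Ico i b) R)
    (hQ' : IsNCPart (Finset.Ico (a + 1) i) Q') (hR' : IsNCPart (Finset.Ico i b) R')
    (h : Q ∪ R.image (attach a i) = Q' ∪ R'.image (attach a i)) : Q ⊆ Q' ∧ R ⊆ R' := by
  constructor
  · intro B hB
    have h1 : B ∈ Q' ∪ R'.image (attach a i) := h ▸ Finset.mem_union_left _ hB
    rcases Finset.mem_union.1 h1 with h1 | h1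
    · exact h1
    · exfalso
      obtain ⟨C, hC, rfl⟩ := Finset.mem_image.1 h1
      obtain ⟨x, hx⟩ := hR'.nonempty C hC
      have h2 := Finset.mem_Ico.1 (hR'.subset C hC x hx)
      have h3 := Finset.mem_Ico.1 (hQ.subset _ hB x (mem_attach.2 (Or.inl hx)))
      omega
  · intro B hB
    obtain ⟨x, hx⟩ := hR.nonempty B hB
    have h1 : attach a i B ∈ Q' ∪ R'.image (attach a i) :=
      h ▸ Finset.mem_union_right _ (Finset.mem_image_of_mem _ hB)
    rcases Finset.mem_union.1 h1 with h1 | h1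
    · have h2 := Finset.mem_Ico.1 (hR.subset B hB x hx)
      have h3 := Finset.mem_Ico.1 (hQ'.subset _ h1 x (mem_attach.2 (Or.inl hx)))
      omega
    · obtain ⟨C, hC, hCB⟩ := Finset.mem_image.1 h1
      have hB' : a ∉ B := fun h2 => by
        have := Finset.mem_Ico.1 (hR.subset B hB a h2); omega
      have hC' : a ∉ C := fun h2 => by
        have := Finset.mem_Ico.1 (hR'.subset C hC a h2); omega
      rwa [← erase_attach hB', ← hCB, erase_attach hC']

theorem IsNCPart.exists_glue {a i b : ℕ} {P : Finset (Finset ℕ)}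
    (hP : IsNCPart (Finset.Ico a b) P) (hi : IsNext a i P) :
    ∃ Q R, IsNCPart (Finset.Ico (a + 1) i) Q ∧ IsNCPart (Finset.Ico i b) R ∧
      Q ∪ R.image (attach a i) = P := by
  classical
  obtain ⟨B₀, hB₀, ha, hi, hai, hmin⟩ := hi
  have hsub : ∀ B ∈ P, ∀ x ∈ B, a ≤ x ∧ x < b := fun B hB x hx =>
    Finset.mem_Ico.1 (hP.subset B hB x hx)
  -- A block different from that of `a` and `i` cannot meet both sides of `i` without crossing it.
  have key : ∀ B ∈ P, B ≠ B₀ → (∀ x ∈ B, a < x ∧ x < i) ∨ (∀ x ∈ B, i < x) := by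
    intro B hB hne
    have hax : ∀ x ∈ B, a < x ∧ x ≠ i := fun x hx =>
      ⟨lt_of_le_of_ne (hsub B hB x hx).1 fun h =>
        hne (hP.eq_of_mem B hB B₀ hB₀ x hx (h ▸ ha)), fun h =>
        hne (hP.eq_of_mem B hB B₀ hB₀ x hx (h ▸ hi))⟩
    by_contra! hcon
    obtain ⟨⟨y, hy, hyi⟩, x, hx, hxi⟩ := hcon
    have h1 := hax x hx
    have h2 := hax y hy
    have h3 := hyi h2.1
    exact hne (hP.noncrossing B₀ hB₀ B hB a ha x hx i hi y hy h1.1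
      (by omega) (by omega)).symm
  have hB₀i : ∀ x ∈ B₀, x = a ∨ i ≤ x := fun x hx => by
    rcases eq_or_lt_of_le (hsub B₀ hB₀ x hx).1 with h | h
    · exact Or.inl h.symm
    · exact Or.inr (hmin x hx h)
  have hib := (hsub B₀ hB₀ i hi).2
  set Q := P.filter (fun B => ∀ x ∈ B, a < x ∧ x < i) with hQ
  set R := (P.filter (fun B => ¬ ∀ x ∈ B, a < x ∧ x < i)).image (fun B => B.erase a) with hR
  have memQ : ∀ B, B ∈ Q ↔ B ∈ P ∧ ∀ x ∈ B, a < x ∧ x < i := fun B => by simp [hQ]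
  have memR : ∀ C, C ∈ R ↔ C = B₀.erase a ∨ (C ∈ P ∧ ∀ x ∈ C, i < x) := by
    intro C
    rw [hR, Finset.mem_image]
    constructor
    · rintro ⟨B, hB, rfl⟩
      rw [Finset.mem_filter] at hB
      by_cases h : B = B₀
      · exact Or.inl (by rw [h])
      · have h1 := (key B hB.1 h).resolve_left hB.2
        have : B.erase a = B := Finset.erase_eq_of_notMem fun h2 => by
          have := h1 a h2; omega
        rw [this]
        exact Or.inr ⟨hB.1, h1⟩
    · rintro (rfl | ⟨hC, h1⟩)
      · refine ⟨B₀, Finset.mem_filter.2 ⟨hB₀, fun h => ?_⟩, rfl⟩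
        have := h a ha; omega
      · refine ⟨C, Finset.mem_filter.2 ⟨hC, fun h => ?_⟩, Finset.erase_eq_of_notMem fun h2 => ?_⟩
        · obtain ⟨x, hx⟩ := hP.nonempty C hC
          have := h x hx; have := h1 x hx; omega
        · have := h1 a h2; omega
  have hRP : ∀ C ∈ R, ∃ B ∈ P, (∀ x ∈ C, x ∈ B) ∧ (∀ x ∈ B, a < x → x ∈ C) ∧ C = B.erase a := by
    intro C hC
    rcases (memR C).1 hC with rfl | ⟨hC, h1⟩
    · exact ⟨B₀, hB₀, fun x hx => Finset.mem_of_mem_erase hx,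
        fun x hx h => Finset.mem_erase.2 ⟨h.ne', hx⟩, rfl⟩
    · refine ⟨C, hC, fun x hx => hx, fun x hx _ => hx,
        (Finset.erase_eq_of_notMem fun h2 => ?_).symm⟩
      have := h1 a h2; omega
  have hRi : ∀ C ∈ R, ∀ x ∈ C, i ≤ x ∧ x < b := by
    intro C hC x hx
    rcases (memR C).1 hC with rfl | ⟨hC, h1⟩
    · have h2 := Finset.mem_erase.1 hx
      exact ⟨(hB₀i x h2.2).resolve_left h2.1, (hsub B₀ hB₀ x h2.2).2⟩
    · exact ⟨(h1 x hx).le, (hsub C hC x hx).2⟩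
  refine ⟨Q, R, ⟨?_, ?_, ?_, ?_, ?_⟩, ⟨?_, ?_, ?_, ?_, ?_⟩, ?_⟩
  · exact fun B hB => hP.nonempty B ((memQ B).1 hB).1
  · intro B hB x hx
    have := ((memQ B).1 hB).2 x hx
    rw [Finset.mem_Ico]; omega
  · intro x hx
    rw [Finset.mem_Ico] at hx
    obtain ⟨B, hB, hxB⟩ := hP.cover x (Finset.mem_Ico.2 (by omega))
    refine ⟨B, (memQ B).2 ⟨hB, ?_⟩, hxB⟩
    have hne : B ≠ B₀ := by
      rintro rfl
      have := hB₀i x hxB; omega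
    refine (key B hB hne).resolve_right fun h => ?_
    have := h x hxB; omega
  · exact fun B hB C hC => hP.eq_of_mem B ((memQ B).1 hB).1 C ((memQ C).1 hC).1
  · exact fun B hB C hC => hP.noncrossing B ((memQ B).1 hB).1 C ((memQ C).1 hC).1
  · intro C hC
    rcases (memR C).1 hC with rfl | ⟨hC, h1⟩
    · exact ⟨i, Finset.mem_erase.2 ⟨hai.ne', hi⟩⟩
    · exact hP.nonempty C hC
  · exact fun C hC x hx => Finset.mem_Ico.2 (hRi C hC x hx)
  · intro x hx
    rw [Finset.mem_Ico] at hx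
    obtain ⟨B, hB, hxB⟩ := hP.cover x (Finset.mem_Ico.2 (by omega))
    by_cases h : B = B₀
    · subst h
      exact ⟨B.erase a, (memR _).2 (Or.inl rfl), Finset.mem_erase.2 ⟨by omega, hxB⟩⟩
    · refine ⟨B, (memR B).2 (Or.inr ⟨hB, (key B hB h).resolve_left fun h1 => ?_⟩), hxB⟩
      have := h1 x hxB; omega
  · intro B hB C hC x hxB hxC
    obtain ⟨B', hB', h1, -, rfl⟩ := hRP B hB
    obtain ⟨C', hC', h3, -, rfl⟩ := hRP C hC
    rw [hP.eq_of_mem B' hB' C' hC' x (h1 x hxB) (h3 x hxC)]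
  · intro B hB C hC p hp q hq r hr s hs hpq hqr hrs
    obtain ⟨B', hB', h1, -, rfl⟩ := hRP B hB
    obtain ⟨C', hC', h3, -, rfl⟩ := hRP C hC
    rw [hP.noncrossing B' hB' C' hC' p (h1 p hp) q (h3 q hq) r (h1 r hr) s (h3 s hs) hpq hqr hrs]
  · have hat0 : attach a i (B₀.erase a) = B₀ := by
      rw [attach, if_pos (Finset.mem_erase.2 ⟨hai.ne', hi⟩), Finset.insert_erase ha]
    have hat : ∀ C, (∀ x ∈ C, i < x) → attach a i C = C := fun C hC => by
      rw [attach, if_neg fun h => lt_irrefl _ (hC i h)]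
    ext B
    rw [Finset.mem_union, Finset.mem_image, memQ]
    constructor
    · rintro (h | ⟨C, hC, rfl⟩)
      · exact h.1
      · rcases (memR C).1 hC with rfl | ⟨hC, h1⟩
        · rwa [hat0]
        · rwa [hat C h1]
    · intro hB
      by_cases h : B = B₀
      · subst h
        exact Or.inr ⟨_, (memR _).2 (Or.inl rfl), hat0⟩
      · rcases key B hB h with h1 | h1
        · exact Or.inl ⟨hB, h1⟩
        · exact Or.inr ⟨B, (memR B).2 (Or.inr ⟨hB, h1⟩), hat B h1⟩

/-- Deleting `a` shortens its block by one. The lost point is booked as one more additional point of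
the block now rooted at `i`, hence `j + 1`. -/
theorem rootedWeight_glue {R : Type*} [CommSemiring R] (κ : ℕ → R) (j : ℕ) {a i b : ℕ} (hai : a < i)
    {P Q : Finset (Finset ℕ)}
    (hP : IsNCPart (Finset.Ico (a + 1) i) P) (hQ : IsNCPart (Finset.Ico i b) Q) :
    rootedWeight κ a j (P ∪ Q.image (attach a i)) =
      rootedWeight κ (a + 1) 0 P * rootedWeight κ i (j + 1) Q := by
  classical
  have hQa : ∀ B ∈ Q, a ∉ B := fun B hB h => by
    have := Finset.mem_Ico.1 (hQ.subset B hB a h); omega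
  have hPa : ∀ B ∈ P, a ∉ B := fun B hB h => by
    have := Finset.mem_Ico.1 (hP.subset B hB a h); omega
  unfold rootedWeight
  rw [Finset.prod_union, Finset.prod_image]
  · congr 1
    · exact Finset.prod_congr rfl fun B hB => by simp [hPa B hB]
    · refine Finset.prod_congr rfl fun B hB => ?_
      by_cases h : i ∈ B
      · have : attach a i B = insert a B := if_pos h
        rw [if_pos h, if_pos (by rw [this]; exact Finset.mem_insert_self _ _), this,
          Finset.card_insert_of_notMem (hQa B hB)]
        congr 1; omega
      · have : attach a i B = B := if_neg h
        rw [this, if_neg h, if_neg (hQa B hB)]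
  · intro B hB C hC h
    rw [← erase_attach (i := i) (hQa B hB), ← erase_attach (i := i) (hQa C hC)]
    exact congrArg (fun D => D.erase a) h
  · rw [Finset.disjoint_left]
    intro B hB hB1
    obtain ⟨C, hC, rfl⟩ := Finset.mem_image.1 hB1
    obtain ⟨x, hx⟩ := hQ.nonempty C hC
    have h2 := Finset.mem_Ico.1 (hQ.subset C hC x hx)
    have h3 := Finset.mem_Ico.1 (hP.subset _ hB x (mem_attach.2 (Or.inl hx)))
    omega

open Classical in
theorem sum_rootedWeight_isNext {R : Type*} [CommSemiring R] (κ : ℕ → R) (j : ℕ) {a i b : ℕ}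
    (hai : a < i) (hib : i < b) :
    ∑ P ∈ (ncParts (Finset.Ico a b)).filter (IsNext a i), rootedWeight κ a j P =
      rootedSum κ (a + 1) 0 (Finset.Ico (a + 1) i) * rootedSum κ i (j + 1) (Finset.Ico i b) := by
  rw [rootedSum, rootedSum, Finset.sum_mul_sum, ← Finset.sum_product']
  symm
  refine Finset.sum_bij (fun p _ => p.1 ∪ p.2.image (attach a i)) ?_ ?_ ?_ ?_
  · intro p hp
    rw [Finset.mem_product, mem_ncParts, mem_ncParts] at hp
    rw [Finset.mem_filter, mem_ncParts]
    exact hp.1.glue hai hib hp.2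
  · intro p hp q hq h
    rw [Finset.mem_product, mem_ncParts, mem_ncParts] at hp hq
    have h1 := hp.1.glue_injective hai hp.2 hq.1 hq.2 h
    have h2 := hq.1.glue_injective hai hq.2 hp.1 hp.2 h.symm
    exact Prod.ext (h1.1.antisymm h2.1) (h1.2.antisymm h2.2)
  · intro P hP
    rw [Finset.mem_filter, mem_ncParts] at hP
    obtain ⟨Q, R, hQ, hR, h⟩ := hP.1.exists_glue hP.2
    exact ⟨(Q, R), by rw [Finset.mem_product, mem_ncParts, mem_ncParts]; exact ⟨hQ, hR⟩, h⟩
  · intro p hp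
    rw [Finset.mem_product, mem_ncParts, mem_ncParts] at hp
    exact (rootedWeight_glue κ j hai hp.1 hp.2).symm

theorem IsNCPart.insert_singleton {a b : ℕ} (hab : a < b) {Q : Finset (Finset ℕ)}
    (hQ : IsNCPart (Finset.Ico (a + 1) b) Q) : IsNCPart (Finset.Ico a b) (insert {a} Q) := by
  have hQ' : ∀ B ∈ Q, ∀ x ∈ B, a < x ∧ x < b := fun B hB x hx => by
    have := Finset.mem_Ico.1 (hQ.subset B hB x hx); omega
  refine ⟨?_, ?_, ?_, ?_, ?_⟩
  · intro B hB
    rcases Finset.mem_insert.1 hB with rfl | hB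
    · exact Finset.singleton_nonempty a
    · exact hQ.nonempty B hB
  · intro B hB x hx
    rw [Finset.mem_Ico]
    rcases Finset.mem_insert.1 hB with rfl | hB
    · rw [Finset.mem_singleton.1 hx]; omega
    · have := hQ' B hB x hx; omega
  · intro x hx
    rw [Finset.mem_Ico] at hx
    rcases eq_or_lt_of_le hx.1 with rfl | h
    · exact ⟨{a}, Finset.mem_insert_self _ _, Finset.mem_singleton_self _⟩
    · obtain ⟨B, hB, hxB⟩ := hQ.cover x (Finset.mem_Ico.2 ⟨h, hx.2⟩)
      exact ⟨B, Finset.mem_insert_of_mem hB, hxB⟩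
  · intro B hB C hC x hxB hxC
    rcases Finset.mem_insert.1 hB with rfl | hB <;> rcases Finset.mem_insert.1 hC with rfl | hC
    · rfl
    · have := hQ' C hC x hxC; have := Finset.mem_singleton.1 hxB; omega
    · have := hQ' B hB x hxB; have := Finset.mem_singleton.1 hxC; omega
    · exact hQ.eq_of_mem B hB C hC x hxB hxC
  · intro B hB C hC p hp q hq r hr s hs hpq hqr hrs
    rcases Finset.mem_insert.1 hB with rfl | hB <;> rcases Finset.mem_insert.1 hC with rfl | hC
    · rfl
    · have := Finset.mem_singleton.1 hp; have := Finset.mem_singleton.1 hr; omega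
    · have := Finset.mem_singleton.1 hq; have := Finset.mem_singleton.1 hs; omega
    · exact hQ.noncrossing B hB C hC p hp q hq r hr s hs hpq hqr hrs

theorem IsNCPart.erase_singleton {a b : ℕ} {P : Finset (Finset ℕ)}
    (hP : IsNCPart (Finset.Ico a b) P) (h : {a} ∈ P) :
    IsNCPart (Finset.Ico (a + 1) b) (P.erase {a}) := by
  refine ⟨fun B hB => hP.nonempty B (Finset.mem_of_mem_erase hB), ?_, ?_,
    fun B hB C hC => hP.eq_of_mem B (Finset.mem_of_mem_erase hB) C (Finset.mem_of_mem_erase hC),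
    fun B hB C hC => hP.noncrossing B (Finset.mem_of_mem_erase hB) C (Finset.mem_of_mem_erase hC)⟩
  · intro B hB x hx
    have hB := Finset.mem_erase.1 hB
    have h1 := Finset.mem_Ico.1 (hP.subset B hB.2 x hx)
    have h2 : x ≠ a := by
      rintro rfl
      exact hB.1 (hP.eq_of_mem B hB.2 {x} h x hx (Finset.mem_singleton_self _))
    rw [Finset.mem_Ico]; omega
  · intro x hx
    rw [Finset.mem_Ico] at hx
    obtain ⟨B, hB, hxB⟩ := hP.cover x (Finset.mem_Ico.2 (by omega))
    refine ⟨B, Finset.mem_erase.2 ⟨?_, hB⟩, hxB⟩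
    rintro rfl
    have := Finset.mem_singleton.1 hxB; omega

open Classical in
theorem sum_rootedWeight_singleton {R : Type*} [CommSemiring R] (κ : ℕ → R) (j : ℕ) {a b : ℕ}
    (hab : a < b) :
    ∑ P ∈ (ncParts (Finset.Ico a b)).filter ({a} ∈ ·), rootedWeight κ a j P =
      κ (j + 1) * rootedSum κ (a + 1) 0 (Finset.Ico (a + 1) b) := by
  rw [rootedSum, Finset.mul_sum]
  symm
  have hna : ∀ Q, IsNCPart (Finset.Ico (a + 1) b) Q → ∀ B ∈ Q, a ∉ B := fun Q hQ B hB h => by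
    have := Finset.mem_Ico.1 (hQ.subset B hB a h); omega
  have hna' : ∀ Q, IsNCPart (Finset.Ico (a + 1) b) Q → {a} ∉ Q := fun Q hQ h =>
    hna Q hQ _ h (Finset.mem_singleton_self _)
  refine Finset.sum_bij' (fun Q _ => insert {a} Q) (fun P _ => P.erase {a}) ?_ ?_ ?_ ?_ ?_
  · intro Q hQ
    rw [mem_ncParts] at hQ
    rw [Finset.mem_filter, mem_ncParts]
    exact ⟨hQ.insert_singleton hab, Finset.mem_insert_self _ _⟩
  · intro P hP
    rw [Finset.mem_filter, mem_ncParts] at hP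
    rw [mem_ncParts]
    exact hP.1.erase_singleton hP.2
  · intro Q hQ
    rw [mem_ncParts] at hQ
    exact Finset.erase_insert (hna' Q hQ)
  · intro P hP
    exact Finset.insert_erase (Finset.mem_filter.1 hP).2
  · intro Q hQ
    rw [mem_ncParts] at hQ
    simp only [rootedWeight]
    rw [Finset.prod_insert (hna' Q hQ)]
    congr 1
    · simp [add_comm]
    · exact Finset.prod_congr rfl fun B hB => by simp [hna Q hQ B hB]

theorem IsNCPart.existsUnique_isNext {a b : ℕ} (hab : a < b) {P : Finset (Finset ℕ)}
    (hP : IsNCPart (Finset.Ico a b) P) (h : {a} ∉ P) :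
    ∃ i, a < i ∧ i < b ∧ ∀ k, IsNext a k P ↔ k = i := by
  obtain ⟨B, hB, haB⟩ := hP.cover a (Finset.mem_Ico.2 ⟨le_rfl, hab⟩)
  have hne : (B.erase a).Nonempty := by
    rw [Finset.nonempty_iff_ne_empty]
    intro h1
    rcases (Finset.erase_eq_empty_iff B a).1 h1 with h2 | h2
    · simp [h2] at haB
    · exact h (h2 ▸ hB)
  have h1 := Finset.mem_erase.1 ((B.erase a).min'_mem hne)
  have h2 := Finset.mem_Ico.1 (hP.subset B hB _ h1.2)
  have h3 : a < (B.erase a).min' hne := lt_of_le_of_ne h2.1 h1.1.symm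
  have h4 : ∀ k ∈ B, a < k → (B.erase a).min' hne ≤ k := fun k hk hak =>
    Finset.min'_le _ _ (Finset.mem_erase.2 ⟨hak.ne', hk⟩)
  refine ⟨(B.erase a).min' hne, h3, h2.2, fun k => ⟨?_, ?_⟩⟩
  · rintro ⟨C, hC, haC, hkC, hak, hmin⟩
    obtain rfl := hP.eq_of_mem B hB C hC a haB haC
    exact le_antisymm (hmin _ h1.2 h3) (h4 k hkC hak)
  · rintro rfl
    exact ⟨B, hB, haB, h1.2, h3, h4⟩

theorem IsNext.singleton_notMem {S : Finset ℕ} {a i : ℕ} {P : Finset (Finset ℕ)}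
    (hP : IsNCPart S P) (h : IsNext a i P) : {a} ∉ P := by
  intro h1
  obtain ⟨B, hB, haB, hiB, hai, -⟩ := h
  obtain rfl := hP.eq_of_mem B hB {a} h1 a haB (Finset.mem_singleton_self _)
  have := Finset.mem_singleton.1 hiB; omega

/-- Splitting a noncrossing partition at the second element of its first block. -/
theorem rootedSum_Ico {R : Type*} [CommSemiring R] (κ : ℕ → R) (j : ℕ) {a b : ℕ} (hab : a < b) :
    rootedSum κ a j (Finset.Ico a b) =
      κ (j + 1) * rootedSum κ (a + 1) 0 (Finset.Ico (a + 1) b) +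
      ∑ i ∈ Finset.Ioo a b, rootedSum κ (a + 1) 0 (Finset.Ico (a + 1) i) *
        rootedSum κ i (j + 1) (Finset.Ico i b) := by
  classical
  rw [rootedSum, ← Finset.sum_filter_add_sum_filter_not _ ({a} ∈ ·),
    sum_rootedWeight_singleton κ j hab]
  congr 1
  -- With the second element encoded as an indicator, exchanging the two sums leaves exactly one `i`
  -- for each partition in which `{a}` is not a block.
  have : ∀ i ∈ Finset.Ioo a b, rootedSum κ (a + 1) 0 (Finset.Ico (a + 1) i) *
        rootedSum κ i (j + 1) (Finset.Ico i b) =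
        ∑ P ∈ (ncParts (Finset.Ico a b)).filter (fun P => {a} ∉ P),
          if IsNext a i P then rootedWeight κ a j P else 0 := by
    intro i hi
    rw [Finset.mem_Ioo] at hi
    rw [← sum_rootedWeight_isNext κ j hi.1 hi.2, ← Finset.sum_filter, Finset.filter_filter]
    refine Finset.sum_congr (Finset.filter_congr fun P hP => ?_) fun _ _ => rfl
    exact ⟨fun h => ⟨h.singleton_notMem (mem_ncParts.1 hP), h⟩, fun h => h.2⟩
  rw [Finset.sum_congr rfl this, Finset.sum_comm]
  refine Finset.sum_congr rfl fun P hP => ?_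
  rw [Finset.mem_filter, mem_ncParts] at hP
  obtain ⟨i, hai, hib, hi⟩ := hP.1.existsUnique_isNext hab hP.2
  simp only [hi]
  rw [Finset.sum_ite_eq' , if_pos (Finset.mem_Ioo.2 ⟨hai, hib⟩)]

theorem rootedSum_empty {R : Type*} [CommSemiring R] (κ : ℕ → R) (r j : ℕ) :
    rootedSum κ r j ∅ = 1 := by
  have : ncParts ∅ = {∅} := by
    ext P
    rw [mem_ncParts, Finset.mem_singleton]
    constructor
    · intro h
      rw [Finset.eq_empty_iff_forall_notMem]
      intro B hB
      obtain ⟨x, hx⟩ := h.nonempty B hB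
      simpa using h.subset B hB x hx
    · rintro rfl
      exact ⟨by simp, by simp, by simp, by simp, by simp⟩
  simp [rootedSum, this, rootedWeight]

/-- The rooted sums only depend on the number of points. -/
theorem rootedSum_Ico_eq {R : Type*} [CommSemiring R] (κ : ℕ → R) (n : ℕ) :
    ∀ j a a' : ℕ, rootedSum κ a j (Finset.Ico a (a + n)) =
      rootedSum κ a' j (Finset.Ico a' (a' + n)) := by
  induction n using Nat.strong_induction_on with
  | _ n ih =>
    intro j a a'
    rcases Nat.eq_zero_or_pos n with rfl | hn
    · simp [rootedSum_empty]
    · rw [rootedSum_Ico κ j (by omega : a < a + n), rootedSum_Ico κ j (by omega : a' < a' + n)]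
      have key : ∀ a, κ (j + 1) * rootedSum κ (a + 1) 0 (Finset.Ico (a + 1) (a + n)) +
          ∑ i ∈ Finset.Ioo a (a + n), rootedSum κ (a + 1) 0 (Finset.Ico (a + 1) i) *
            rootedSum κ i (j + 1) (Finset.Ico i (a + n)) =
          κ (j + 1) * rootedSum κ 0 0 (Finset.Ico 0 (n - 1)) +
          ∑ i ∈ Finset.Ioo 0 n, rootedSum κ 0 0 (Finset.Ico 0 (i - 1)) *
            rootedSum κ 0 (j + 1) (Finset.Ico 0 (n - i)) := by
        intro a
        congr 1
        · have := ih (n - 1) (by omega) 0 (a + 1) 0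
          rw [show a + 1 + (n - 1) = a + n by omega, zero_add] at this
          rw [this]
        · refine Finset.sum_bij' (fun i _ => i - a) (fun i _ => i + a) ?_ ?_ ?_ ?_ ?_
          · intro i hi; rw [Finset.mem_Ioo] at *; omega
          · intro i hi; rw [Finset.mem_Ioo] at *; omega
          · intro i hi; rw [Finset.mem_Ioo] at hi; omega
          · intro i hi; rw [Finset.mem_Ioo] at hi; omega
          · intro i hi
            rw [Finset.mem_Ioo] at hi
            have h1 := ih (i - a - 1) (by omega) 0 (a + 1) 0
            have h2 := ih (n - (i - a)) (by omega) (j + 1) i 0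
            rw [show a + 1 + (i - a - 1) = i by omega, zero_add] at h1
            rw [show i + (n - (i - a)) = a + n by omega, zero_add] at h2
            rw [h1, h2]
      rw [key, key]

theorem ncMoment_eq_rootedSum {R : Type*} [CommSemiring R] (κ : ℕ → R) (n : ℕ) :
    ncMoment κ n = rootedSum κ 0 0 (Finset.Ico 0 n) := by
  classical
  have hinj : Function.Injective (fun B : Finset (Fin n) => B.map Fin.valEmbedding) :=
    Finset.map_injective _
  unfold ncMoment rootedSum
  refine Finset.sum_bij (fun π _ => π.parts.image fun B => B.map Fin.valEmbedding) ?_ ?_ ?_ ?_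
  · intro π hπ
    have hnc : IsNoncrossing π := (Finset.mem_filter.1 hπ).2
    rw [mem_ncParts]
    refine ⟨?_, ?_, ?_, ?_, ?_⟩
    · intro B hB
      obtain ⟨C, hC, rfl⟩ := Finset.mem_image.1 hB
      exact (π.nonempty_of_mem_parts hC).map
    · intro B hB x hx
      obtain ⟨C, hC, rfl⟩ := Finset.mem_image.1 hB
      obtain ⟨y, hy, rfl⟩ := Finset.mem_map.1 hx
      simp
    · intro x hx
      rw [Finset.mem_Ico] at hx
      obtain ⟨B, hB, hxB⟩ := π.exists_mem (Finset.mem_univ (⟨x, hx.2⟩ : Fin n))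
      exact ⟨_, Finset.mem_image_of_mem _ hB, Finset.mem_map.2 ⟨_, hxB, rfl⟩⟩
    · intro B hB C hC x hxB hxC
      obtain ⟨B', hB', rfl⟩ := Finset.mem_image.1 hB
      obtain ⟨C', hC', rfl⟩ := Finset.mem_image.1 hC
      obtain ⟨y, hy, rfl⟩ := Finset.mem_map.1 hxB
      have hyC : y ∈ C' := (Finset.mem_map' _).1 hxC
      rw [π.eq_of_mem_parts hB' hC' hy hyC]
    · intro B hB C hC p hp q hq r hr s hs hpq hqr hrs
      obtain ⟨B', hB', rfl⟩ := Finset.mem_image.1 hB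
      obtain ⟨C', hC', rfl⟩ := Finset.mem_image.1 hC
      obtain ⟨p, hp', rfl⟩ := Finset.mem_map.1 hp
      obtain ⟨q, hq', rfl⟩ := Finset.mem_map.1 hq
      obtain ⟨r, hr', rfl⟩ := Finset.mem_map.1 hr
      obtain ⟨s, hs', rfl⟩ := Finset.mem_map.1 hs
      rw [hnc B' hB' C' hC' p hp' q hq' r hr' s hs' hpq hqr hrs]
  · intro π _ ρ _ h
    exact Finpartition.ext (Finset.image_injective hinj h)
  · intro P hP
    rw [mem_ncParts] at hP
    set f : Finset ℕ → Finset (Fin n) := fun B => Finset.univ.filter fun i => (i : ℕ) ∈ B with hf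
    have hmap : ∀ B ∈ P, (f B).map Fin.valEmbedding = B := by
      intro B hB
      ext x
      simp only [hf, Finset.mem_map, Finset.mem_filter, Finset.mem_univ, true_and]
      constructor
      · rintro ⟨i, hi, rfl⟩; exact hi
      · intro hx
        exact ⟨⟨x, (Finset.mem_Ico.1 (hP.subset B hB x hx)).2⟩, hx, rfl⟩
    have hmem : ∀ B i, i ∈ f B ↔ (i : ℕ) ∈ B := fun B i => by simp [hf]
    have himg : (P.image f).image (fun B => B.map Fin.valEmbedding) = P := by
      rw [Finset.image_image]
      ext B
      rw [Finset.mem_image]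
      constructor
      · rintro ⟨C, hC, rfl⟩
        simpa [hmap C hC] using hC
      · intro hB; exact ⟨B, hB, hmap B hB⟩
    let π : Finpartition (Finset.univ : Finset (Fin n)) := Finpartition.ofExistsUnique (P.image f)
      (fun _ _ => Finset.subset_univ _)
      (by
        intro i _
        obtain ⟨B, hB, hiB⟩ := hP.cover i (Finset.mem_Ico.2 ⟨Nat.zero_le _, i.2⟩)
        refine ⟨f B, ⟨Finset.mem_image_of_mem _ hB, (hmem B i).2 hiB⟩, ?_⟩
        rintro C ⟨hC, hiC⟩
        obtain ⟨D, hD, rfl⟩ := Finset.mem_image.1 hC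
        rw [hP.eq_of_mem D hD B hB i ((hmem D i).1 hiC) hiB])
      (by
        intro h
        obtain ⟨C, hC, h⟩ := Finset.mem_image.1 h
        have := hmap C hC
        rw [h, Finset.map_empty] at this
        have h2 := hP.nonempty C hC
        rw [← this] at h2
        exact Finset.not_nonempty_empty h2)
    refine ⟨π, Finset.mem_filter.2 ⟨Finset.mem_univ _, ?_⟩, himg⟩
    intro B hB C hC p hp q hq r hr s hs hpq hqr hrs
    obtain ⟨B, hB', rfl⟩ := Finset.mem_image.1 hB
    obtain ⟨C, hC', rfl⟩ := Finset.mem_image.1 hC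
    rw [hmem] at hp hq hr hs
    rw [hP.noncrossing B hB' C hC' p hp q hq r hr s hs hpq hqr hrs]
  · intro π _
    rw [rootedWeight, Finset.prod_image fun _ _ _ _ h => hinj h]
    simp

/-! ### Generating series and the functional equation M = Φ(tM) -/

open PowerSeries in
/-- The generating series of the sums in which the first block counts `j` additional points. -/
noncomputable def rootedSeries (κ : ℕ → ℝ) (j : ℕ) : ℝ⟦X⟧ :=
  -- The constant term is `κ j`, the weight of a block made of the `j` additional points alone;
  -- `rootedSum` over `∅` would give 1. With this convention the singleton term of the recursion
  -- becomes the last term of a convolution.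
  PowerSeries.mk fun n => if n = 0 then κ j else rootedSum κ 0 j (Finset.Ico 0 n)

open PowerSeries in
/-- The generating series of the moments. -/
noncomputable def momentSeries (κ : ℕ → ℝ) : ℝ⟦X⟧ :=
  PowerSeries.mk fun n => rootedSum κ 0 0 (Finset.Ico 0 n)

open PowerSeries in
theorem coeff_momentSeries (κ : ℕ → ℝ) (n : ℕ) : coeff n (momentSeries κ) = ncMoment κ n := by
  rw [momentSeries, coeff_mk, ncMoment_eq_rootedSum]

open PowerSeries in
theorem rootedSeries_eq (κ : ℕ → ℝ) (j : ℕ) :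
    rootedSeries κ j = C (κ j) + X * (momentSeries κ * rootedSeries κ (j + 1)) := by
  ext n
  rcases n with _ | k
  · simp [rootedSeries]
  · rw [map_add, coeff_succ_X_mul, coeff_mul, coeff_C, if_neg (Nat.succ_ne_zero k), zero_add,
      Finset.Nat.sum_antidiagonal_eq_sum_range_succ
        (fun i l => coeff i (momentSeries κ) * coeff l (rootedSeries κ (j + 1))) k,
      Finset.sum_range_succ, rootedSeries, coeff_mk, if_neg (Nat.succ_ne_zero k),
      rootedSum_Ico κ j (Nat.succ_pos k), add_comm]
    congr 1
    · refine Finset.sum_bij' (fun i _ => i - 1) (fun i _ => i + 1) ?_ ?_ ?_ ?_ ?_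
      · intro i hi; rw [Finset.mem_Ioo] at hi; rw [Finset.mem_range]; omega
      · intro i hi; rw [Finset.mem_range] at hi; rw [Finset.mem_Ioo]; omega
      · intro i hi; rw [Finset.mem_Ioo] at hi; omega
      · intro i hi; omega
      · intro i hi
        rw [Finset.mem_Ioo] at hi
        have h1 := rootedSum_Ico_eq κ (i - 1) 0 (0 + 1) 0
        have h2 := rootedSum_Ico_eq κ (k + 1 - i) (j + 1) i 0
        rw [show 0 + 1 + (i - 1) = i by omega, zero_add (i - 1)] at h1
        rw [show i + (k + 1 - i) = k + 1 by omega, zero_add] at h2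
        rw [h1, h2, momentSeries, rootedSeries, coeff_mk, coeff_mk, if_neg (by omega),
          show k - (i - 1) = k + 1 - i by omega]
    · have h1 := rootedSum_Ico_eq κ k 0 (0 + 1) 0
      rw [show 0 + 1 + k = k + 1 by omega, zero_add k] at h1
      rw [h1, Nat.sub_self, momentSeries, coeff_mk, rootedSeries, coeff_mk, if_pos rfl, mul_comm]

open PowerSeries in
-- Each unrolling of the recursion gains a factor `X`, so every coefficient vanishes by induction on
-- its index.
theorem rootedSeries_eq_zero {κ : ℕ → ℝ} {N : ℕ} (h : ∀ j, N ≤ j → κ j = 0) {j : ℕ} (hj : N ≤ j) :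
    rootedSeries κ j = 0 := by
  suffices ∀ n j, N ≤ j → coeff n (rootedSeries κ j) = 0 by
    ext n; rw [this n j hj, map_zero]
  intro n
  induction n using Nat.strong_induction_on with
  | _ n ih =>
    intro j hj
    rw [rootedSeries_eq, h j hj, map_zero, zero_add]
    rcases n with _ | k
    · simp
    · rw [coeff_succ_X_mul, coeff_mul]
      refine Finset.sum_eq_zero fun p hp => ?_
      have hp := Finset.HasAntidiagonal.mem_antidiagonal.1 hp
      rw [ih p.2 (by omega) (j + 1) (by omega), mul_zero]

open PowerSeries in
/-- The functional equation of the moment generating series. -/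
theorem momentSeries_cumulantSeq (x y : ℝ) :
    momentSeries (cumulantSeq x y) = 1 + X ^ 2 * momentSeries (cumulantSeq x y) ^ 2
      + C x * X ^ 3 * momentSeries (cumulantSeq x y) ^ 3
      + C y * X ^ 4 * momentSeries (cumulantSeq x y) ^ 4 := by
  set κ := cumulantSeq x y with hκ
  -- The constant terms agree because `cumulantSeq` takes the default value 0 at index 0.
  have h0 : momentSeries κ = 1 + rootedSeries κ 0 := by
    ext n
    rcases n with _ | n
    · simp [momentSeries, rootedSeries, rootedSum_empty, hκ, cumulantSeq]
    · simp [momentSeries, rootedSeries, coeff_one]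
  have h5 : rootedSeries κ 5 = 0 := by
    refine rootedSeries_eq_zero (N := 5) (fun j hj => ?_) le_rfl
    match j, hj with
    | (n + 5), _ => rfl
  have e0 := rootedSeries_eq κ 0
  have e1 := rootedSeries_eq κ 1
  have e2 := rootedSeries_eq κ 2
  have e3 := rootedSeries_eq κ 3
  have e4 := rootedSeries_eq κ 4
  rw [h5, mul_zero, mul_zero, add_zero] at e4
  rw [e4] at e3
  rw [e3] at e2
  rw [e2] at e1
  rw [e1] at e0
  have k0 : κ 0 = 0 := rfl
  have k1 : κ 1 = 0 := rfl
  have k2 : κ 2 = 1 := rfl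
  have k3 : κ 3 = x := rfl
  have k4 : κ 4 = y := rfl
  rw [k0, k1, k2, k3, k4, map_zero, map_one] at e0
  set M := momentSeries κ
  rw [e0] at h0
  calc M = _ := h0
    _ = _ := by ring

/-! ### Lagrange inversion and growth of the moments -/

open Polynomial in
/-- The polynomial `1 + κ₂ z² + κ₃ z³ + κ₄ z⁴` with `κ₂ = 1`. -/
noncomputable def cumPoly (x y : ℝ) : ℝ[X] := 1 + X ^ 2 + C x * X ^ 3 + C y * X ^ 4

open PowerSeries in
theorem coe_cumPoly (x y : ℝ) :
    (cumPoly x y : ℝ⟦X⟧) = 1 + X ^ 2 + C x * X ^ 3 + C y * X ^ 4 := by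
  simp [cumPoly]

open PowerSeries in
theorem coeff_X_mul_derivative (f : ℝ⟦X⟧) (n : ℕ) :
    coeff n (X * derivative ℝ f) = n * coeff n f := by
  rcases n with _ | n
  · simp
  · rw [coeff_succ_X_mul, coeff_derivative]; push_cast; ring

open PowerSeries in
/-- Lagrange inversion for solutions of `M = Φ(t M)`, where `Φ = 1 + t² + x t³ + y t⁴`. -/
theorem lagrange_cumPoly {x y : ℝ} {M : ℝ⟦X⟧}
    (hM : M = 1 + X ^ 2 * M ^ 2 + C x * X ^ 3 * M ^ 3 + C y * X ^ 4 * M ^ 4) (n : ℕ) :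
    ∀ k : ℕ, ((n : ℝ) + k) * coeff n (M ^ k) =
      k * coeff n ((cumPoly x y : ℝ⟦X⟧) ^ (n + k)) := by
  have hM0 : constantCoeff M = 1 := by rw [hM]; simp
  induction n using Nat.strong_induction_on with
  | _ n ih =>
    intro k
    rcases Nat.eq_zero_or_pos n with rfl | hn
    · simp [hM0, coe_cumPoly]
    have hn' : (0 : ℝ) < n := Nat.cast_pos.2 hn
    induction k with
    | zero => simp [coeff_one, hn.ne']
    | succ k ihk =>
      set Φ : ℝ⟦X⟧ := (cumPoly x y : ℝ⟦X⟧) with hΦ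
      have hΦe := coe_cumPoly x y
      rw [← hΦ] at hΦe
      have hrec : M ^ (k + 1) = M ^ k + X ^ 2 * M ^ (k + 2) + C x * (X ^ 3 * M ^ (k + 3))
          + C y * (X ^ 4 * M ^ (k + 4)) := by
        calc M ^ (k + 1) = M ^ k * M := pow_succ _ _
          _ = M ^ k * (1 + X ^ 2 * M ^ 2 + C x * X ^ 3 * M ^ 3 + C y * X ^ 4 * M ^ 4) := by
              rw [← hM]
          _ = _ := by ring
      -- The factor `X ^ j` lowers the coefficient index to `n - j`, where the outer induction
      -- applies. Since n - j + (k + j) = n + k, all terms acquire the same power of Φ.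
      have hstep : ∀ j, 1 ≤ j → ((n : ℝ) + k) * coeff n (X ^ j * M ^ (k + j)) =
          (k + j) * coeff n (X ^ j * Φ ^ (n + k)) := by
        intro j hj
        rw [coeff_X_pow_mul', coeff_X_pow_mul']
        split_ifs with h
        · have := ih (n - j) (by omega) (k + j)
          rw [show n - j + (k + j) = n + k by omega, Nat.cast_sub h] at this
          push_cast at this
          rw [← this]; ring
        · simp
      have hsum : ((n : ℝ) + k) * coeff n (M ^ (k + 1)) = k * coeff n (Φ ^ (n + k))
          + (k + 2) * coeff n (X ^ 2 * Φ ^ (n + k)) + x * ((k + 3) * coeff n (X ^ 3 * Φ ^ (n + k)))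
          + y * ((k + 4) * coeff n (X ^ 4 * Φ ^ (n + k))) := by
        have h2 := hstep 2 (by norm_num)
        have h3 := hstep 3 (by norm_num)
        have h4 := hstep 4 (by norm_num)
        push_cast at h2 h3 h4
        rw [hrec, map_add, map_add, map_add, coeff_C_mul, coeff_C_mul, ← h2, ← h3, ← h4, ← ihk]
        ring
      have hP : coeff n (Φ ^ (n + k + 1)) = coeff n (Φ ^ (n + k)) + coeff n (X ^ 2 * Φ ^ (n + k))
          + x * coeff n (X ^ 3 * Φ ^ (n + k)) + y * coeff n (X ^ 4 * Φ ^ (n + k)) := by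
        rw [← coeff_C_mul, ← coeff_C_mul, ← map_add, ← map_add, ← map_add]
        congr 1
        rw [pow_succ]
        nth_rewrite 2 [hΦe]
        ring
      -- Euler's operator X d/dX on Φ^(n+k+1) gives the second linear relation needed to eliminate
      -- the shifted coefficients.
      have hD : (n : ℝ) * coeff n (Φ ^ (n + k + 1)) = (n + k + 1) *
          (2 * coeff n (X ^ 2 * Φ ^ (n + k)) + 3 * (x * coeff n (X ^ 3 * Φ ^ (n + k)))
            + 4 * (y * coeff n (X ^ 4 * Φ ^ (n + k)))) := by
        rw [← coeff_X_mul_derivative]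
        have hd : X * derivative ℝ (Φ ^ (n + k + 1)) = C ((n : ℝ) + k + 1) * (
            C 2 * (X ^ 2 * Φ ^ (n + k)) + C 3 * (C x * (X ^ 3 * Φ ^ (n + k)))
            + C 4 * (C y * (X ^ 4 * Φ ^ (n + k)))) := by
          rw [Derivation.leibniz_pow]
          have : derivative ℝ Φ = C 2 * X + C 3 * C x * X ^ 2 + C 4 * C y * X ^ 3 := by
            rw [hΦe]
            simp only [map_add, Derivation.leibniz, Derivation.leibniz_pow, derivative_X,
              derivative_C, Derivation.map_one_eq_zero, smul_eq_mul]
            simp only [map_ofNat]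
            simp only [nsmul_eq_mul]
            push_cast
            ring
          rw [this]
          simp only [smul_eq_mul, nsmul_eq_mul, Nat.add_sub_cancel]
          have hc : ((n + k + 1 : ℕ) : ℝ⟦X⟧) = C ((n : ℝ) + k + 1) := by
            rw [map_add, map_add, map_natCast, map_natCast, map_one]; push_cast; ring
          rw [hc]
          ring
        rw [hd, coeff_C_mul, map_add, map_add]
        simp only [coeff_C_mul]
      rw [show n + (k + 1) = n + k + 1 by ring]
      push_cast
      have hN : (0 : ℝ) < n + k := by positivity
      refine mul_left_cancel₀ hN.ne' ?_
      linear_combination ((n : ℝ) + k + 1) * hsum - (n + k + 1) * k * hP - hD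

open PowerSeries in
/-- The moments with free cumulants `0, 1, x, y, 0, 0, …`. -/
theorem ncMoment_cumulantSeq (x y : ℝ) (n : ℕ) :
    ((n : ℝ) + 1) * ncMoment (cumulantSeq x y) n = (cumPoly x y ^ (n + 1)).coeff n := by
  have := lagrange_cumPoly (momentSeries_cumulantSeq x y) n 1
  rw [pow_one, coeff_momentSeries, Nat.cast_one, one_mul, ← Polynomial.coe_pow,
    Polynomial.coeff_coe] at this
  exact this

open Polynomial in
-- The constant is the sum 1 + 1 + |x| + |y| of the absolute values of the coefficients of Φ, a
-- submultiplicative norm.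
theorem abs_coeff_cumPoly_pow_le (x y : ℝ) (k : ℕ) :
    ∀ n, |(cumPoly x y ^ k).coeff n| ≤ (2 + |x| + |y|) ^ k := by
  induction k with
  | zero => intro n; rw [pow_zero, pow_zero, coeff_one]; split_ifs <;> simp
  | succ k ih =>
    intro n
    have hshift : ∀ j, |(X ^ j * cumPoly x y ^ k).coeff n| ≤ (2 + |x| + |y|) ^ k := by
      intro j
      rw [coeff_X_pow_mul']
      split_ifs
      · exact ih _
      · rw [abs_zero]; positivity
    have h : cumPoly x y ^ (k + 1) = 1 * cumPoly x y ^ k + X ^ 2 * cumPoly x y ^ k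
        + C x * (X ^ 3 * cumPoly x y ^ k) + C y * (X ^ 4 * cumPoly x y ^ k) := by
      rw [pow_succ]
      nth_rewrite 2 [cumPoly]
      ring
    rw [h, coeff_add, coeff_add, coeff_add, coeff_C_mul, coeff_C_mul]
    refine (abs_add_le _ _).trans ?_
    refine (add_le_add_left ((abs_add_le _ _).trans
      (add_le_add_left (abs_add_le _ _) _)) _).trans ?_
    rw [abs_mul, abs_mul, pow_succ (2 + |x| + |y|)]
    have h0 := hshift 0
    rw [pow_zero] at h0
    have h2 := hshift 2
    have h3 := mul_le_mul_of_nonneg_left (hshift 3) (abs_nonneg x)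
    have h4 := mul_le_mul_of_nonneg_left (hshift 4) (abs_nonneg y)
    linarith

theorem abs_ncMoment_cumulantSeq_le (x y : ℝ) (n : ℕ) :
    |ncMoment (cumulantSeq x y) n| ≤ (2 + |x| + |y|) ^ (n + 1) := by
  have h1 := abs_coeff_cumPoly_pow_le x y (n + 1) n
  rw [← ncMoment_cumulantSeq, abs_mul, abs_of_pos (by positivity : (0 : ℝ) < n + 1)] at h1
  refine le_trans ?_ h1
  exact le_mul_of_one_le_left (abs_nonneg _) (by
    have : (0 : ℝ) ≤ n := Nat.cast_nonneg n
    linarith)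

/-! ### The boundary functions and the sign of `curvePoly` -/

/-- The polynomial in `s = 1 / r` whose roots describe the zeros of `Im (1/z + z + x z² + y z³)`
on the ray of points `z = r exp (± i θ)` with `cos θ = c`. -/
def curvePoly (x y c s : ℝ) : ℝ := s ^ 4 - s ^ 2 - 2 * x * c * s - y * (4 * c ^ 2 - 1)

/-- Here s² = (1 + √(1 - 36y))/6 is the larger root of 3T² - T + 3y = 0, the value of T at which a
pair of conjugate critical points of K meets the real axis. -/
theorem f₁_eq {y : ℝ} (h₁ : -(1 / 12) ≤ y) (h₂ : y ≤ 1 / 36) :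
    ∃ s : ℝ, 0 < s ∧ 1 / 6 ≤ s ^ 2 ∧ s ^ 2 ≤ 1 / 2 ∧ 3 * s ^ 4 - s ^ 2 + 3 * y = 0 ∧
      f₁ y = s * (1 - 2 * s ^ 2) := by
  have hw : (0 : ℝ) ≤ 1 - 36 * y := by linarith
  set w := √(1 - 36 * y) with hwdef
  have hw0 : 0 ≤ w := Real.sqrt_nonneg _
  have hw2 : w ^ 2 = 1 - 36 * y := Real.sq_sqrt hw
  have hs2 : √((1 + w) / 6) ^ 2 = (1 + w) / 6 := Real.sq_sqrt (by positivity)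
  have hw3 : w ≤ 2 := by nlinarith
  refine ⟨√((1 + w) / 6), Real.sqrt_pos.2 (by positivity), by rw [hs2]; linarith,
    by rw [hs2]; linarith, ?_, ?_⟩
  · rw [show √((1 + w) / 6) ^ 4 = (√((1 + w) / 6) ^ 2) ^ 2 by ring, hs2]
    linear_combination hw2 / 12
  · rw [hs2, f₁, ← hwdef, Real.sqrt_div (by positivity)]
    have h6 : √(6 : ℝ) ≠ 0 := by positivity
    field_simp
    ring

/-- The inner radicand is the square (6√y - 1)², and 6√y > 1 in this range. -/
theorem f₂_eq {y : ℝ} (h₁ : 1 / 36 < y) (h₂ : y ≤ 1 / 4) :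
    f₂ y = 2 * √y * √(1 - 2 * √y) := by
  have hy : 0 < y := by linarith
  set q := √y with hq
  have hq0 : 0 < q := Real.sqrt_pos.2 hy
  have hq2 : q ^ 2 = y := Real.sq_sqrt hy.le
  have hq6 : 1 / 6 < q := by nlinarith
  rw [f₂]
  split_ifs with h
  · have : q = 1 / 2 := by
      have : (q - 1 / 2) * (q + 1 / 2) = 0 := by rw [h] at hq2; linear_combination hq2
      rcases mul_eq_zero.1 this with h | h <;> linarith
    rw [this]; norm_num
  · have hq12 : q < 1 / 2 := by
      by_contra! hcon
      exact h (le_antisymm h₂ (by nlinarith))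
    have e1 : √(1 - 12 * q + 36 * y) = 6 * q - 1 := by
      rw [show 1 - 12 * q + 36 * y = (6 * q - 1) ^ 2 by rw [← hq2]; ring]
      exact Real.sqrt_sq (by linarith)
    have e2 : y ^ (1 / 4 : ℝ) = √q := by
      rw [hq, Real.sqrt_eq_rpow, Real.sqrt_eq_rpow, ← Real.rpow_mul hy.le]
      norm_num
    have h3 : √(6 : ℝ) = √2 * √3 := by rw [← Real.sqrt_mul (by norm_num)]; norm_num
    have h22 : √(2 : ℝ) ^ 2 = 2 := Real.sq_sqrt (by norm_num)
    have hr : 0 < √(1 - 2 * q) := Real.sqrt_pos.2 (by linarith)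
    have hr2 : √(1 - 2 * q) ^ 2 = 1 - 2 * q := Real.sq_sqrt (by linarith)
    have hqq : √q ^ 2 = q := Real.sq_sqrt hq0.le
    have h30 : √(3 : ℝ) ≠ 0 := by positivity
    rw [← hq, e1, e2, show 1 + (6 * q - 1) = 6 * q by ring, Real.sqrt_mul (by norm_num), h3]
    field_simp
    rw [hqq, hr2, h22]
    ring

theorem exists_curvePoly_nonpos {x y : ℝ} (h : (x, y) ∈ regionD) :
    ∃ s : ℝ, 0 < s ∧ 1 / 6 ≤ s ^ 2 ∧ s ^ 2 < 1 ∧ ∀ c : ℝ, |c| ≤ 1 → curvePoly x y c s ≤ 0 := by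
  rcases h with ⟨h, h₁, h₂⟩ | ⟨h, h₁, h₂⟩
  · simp only at h h₁ h₂
    obtain ⟨s, hs0, hs6, hs2, hsy, hf⟩ := f₁_eq h₁ h₂
    refine ⟨s, hs0, hs6, by linarith, fun c hc => ?_⟩
    rw [hf] at h
    have hk : 0 ≤ |c| := abs_nonneg c
    have hxc : -(x * c) ≤ s * (1 - 2 * s ^ 2) * |c| := by
      refine (neg_le_abs _).trans ?_
      rw [abs_mul]
      exact mul_le_mul_of_nonneg_right h hk
    have hxc' := mul_le_mul_of_nonneg_left hxc hs0.le
    have hcc : c ^ 2 = |c| ^ 2 := (sq_abs c).symm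
    -- After bounding the term in x, the expression is a quadratic in |c| that vanishes at |c| = 1;
    -- it equals s²(1 - |c|) times this linear factor, which is nonpositive because s² ≥ 1/6.
    have hlin : -2 / 3 + (4 / 3 - 4 * s ^ 2) * |c| ≤ 0 := by nlinarith
    have hprod := mul_nonneg (mul_nonneg (sq_nonneg s) (sub_nonneg.2 hc)) (neg_nonneg.2 hlin)
    have hy : y = (s ^ 2 - 3 * s ^ 4) / 3 := by linarith
    rw [curvePoly, hcc, hy]
    nlinarith
  · simp only at h h₁ h₂
    rw [f₂_eq h₁ h₂] at h
    have hy : 0 < y := by linarith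
    have hq0 : 0 < √y := Real.sqrt_pos.2 hy
    have hq2 : √y ^ 2 = y := Real.sq_sqrt hy.le
    set q := √y with hq
    have hq6 : 1 / 6 < q := by nlinarith
    have hq12 : q ≤ 1 / 2 := by nlinarith
    have hs2 : √q ^ 2 = q := Real.sq_sqrt hq0.le
    refine ⟨√q, Real.sqrt_pos.2 hq0, by linarith, by linarith, fun c hc => ?_⟩
    have hx2 : x ^ 2 ≤ 4 * q ^ 2 * (1 - 2 * q) := by
      have h1 : x ^ 2 ≤ (2 * q * √(1 - 2 * q)) ^ 2 := by
        rw [← sq_abs x]; exact pow_le_pow_left₀ (abs_nonneg x) h 2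
      rw [mul_pow, Real.sq_sqrt (by linarith)] at h1
      linarith
    set s := √q with hs
    -- With s² = q = √y, the quartic is a concave quadratic in c; complete the square.
    have e : curvePoly x y c s =
        -(2 * q * c + x * s / (2 * q)) ^ 2 + (x ^ 2 / (4 * q) + 2 * q ^ 2 - q) := by
      rw [curvePoly, ← hq2, show s ^ 4 = (s ^ 2) ^ 2 by ring, hs2]
      have : (x * s / (2 * q)) ^ 2 = x ^ 2 / (4 * q) := by
        rw [div_pow, mul_pow, hs2]; field_simp; ring
      rw [add_sq, this]
      field_simp
      ring
    have h2 : x ^ 2 / (4 * q) ≤ q * (1 - 2 * q) := by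
      rw [div_le_iff₀ (by positivity)]; nlinarith
    rw [e]
    nlinarith [sq_nonneg (2 * q * c + x * s / (2 * q))]

theorem exists_root_ge {x y T₁ : ℝ} (hT₁ : 0 < T₁)
    (h : (T₁ ^ 2 + 3 * y) ^ 2 * (T₁ ^ 2 + T₁ - 3 * y) ≤ 4 * x ^ 2 * T₁ ^ 3) :
    ∃ T, T₁ ≤ T ∧ (T ^ 2 + 3 * y) ^ 2 * (T ^ 2 + T - 3 * y) = 4 * x ^ 2 * T ^ 3 := by
  -- At this point both factors on the left exceed T₂²/2, so the left side is at least T₂⁶/8 and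
  -- dominates the cubic on the right.
  set T₂ := T₁ + 1 + 6 * |y| + 32 * x ^ 2 with hT₂
  have hy0 := abs_nonneg y
  have hx0 := sq_nonneg x
  have h1 : 1 ≤ T₂ := by linarith
  have h12 : T₁ ≤ T₂ := by linarith
  have hy : 6 * |y| ≤ T₂ := by linarith
  have hx : 32 * x ^ 2 ≤ T₂ := by linarith
  have hTT : T₂ ≤ T₂ ^ 2 := by nlinarith
  have ha := neg_abs_le y
  have hb := le_abs_self y
  have h3 : T₂ ^ 2 / 2 ≤ T₂ ^ 2 + 3 * y := by linarith
  have h4 : T₂ ^ 2 / 2 ≤ T₂ ^ 2 + T₂ - 3 * y := by linarith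
  have h5 : (T₂ ^ 2 / 2) ^ 2 * (T₂ ^ 2 / 2) ≤
      (T₂ ^ 2 + 3 * y) ^ 2 * (T₂ ^ 2 + T₂ - 3 * y) := by gcongr
  have h6 : 4 * x ^ 2 * T₂ ^ 3 ≤ (T₂ ^ 2 / 2) ^ 2 * (T₂ ^ 2 / 2) := by
    have h7 : 32 * x ^ 2 ≤ T₂ ^ 3 := hx.trans (le_self_pow₀ h1 three_ne_zero)
    have h8 := mul_le_mul_of_nonneg_right h7 (by positivity : 0 ≤ T₂ ^ 3)
    rw [show (T₂ ^ 2 / 2) ^ 2 * (T₂ ^ 2 / 2) = T₂ ^ 3 * T₂ ^ 3 / 8 by ring]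
    linarith
  obtain ⟨T, hT, hT0⟩ := intermediate_value_Icc h12
    (f := fun T => (T ^ 2 + 3 * y) ^ 2 * (T ^ 2 + T - 3 * y) - 4 * x ^ 2 * T ^ 3)
    (by fun_prop) (show (0 : ℝ) ∈ _ from ⟨by simpa using h, by simpa using h6.trans h5⟩)
  exact ⟨T, hT.1, by simpa [sub_eq_zero] using hT0⟩

/-- T stands for 1/|z₀|². The equation results from eliminating c between the two conditions for 1 -
2cs₀z + s₀²z², with s₀² = T, to divide 1 - z² - 2xz³ - 3yz⁴, the numerator of -K'. The condition on
3T² - T + 3y means c² < 1. The root is sought to the right of a value T₁ depending on the range of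
y: where the left side vanishes if y < -1/12 or y > 1/4, and otherwise where one inequality
degenerates, which is the boundary case of D. -/
theorem exists_critical_modulus {x y : ℝ} (h : (x, y) ∉ regionD) :
    ∃ T : ℝ, 1 / 6 ≤ T ∧ y < T ^ 2 ∧ 0 < 3 * T ^ 2 - T + 3 * y ∧ 0 ≤ T ^ 2 + T - 3 * y ∧
      (T ^ 2 + 3 * y) ^ 2 * (T ^ 2 + T - 3 * y) = 4 * x ^ 2 * T ^ 3 := by
  have hx0 := sq_nonneg x
  rcases lt_or_ge y (-(1 / 12)) with h₁ | h₁
  · have hT2 : √(-3 * y) ^ 2 = -3 * y := Real.sq_sqrt (by linarith)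
    have hT0 : 0 < √(-3 * y) := Real.sqrt_pos.2 (by linarith)
    set T₁ := √(-3 * y)
    have hT1 : 1 / 2 < T₁ := by nlinarith
    obtain ⟨T, hT, e⟩ := exists_root_ge (x := x) (y := y) hT0 (by
      rw [hT2, show -3 * y + 3 * y = 0 by ring]
      have : 0 ≤ 4 * x ^ 2 * T₁ ^ 3 := by positivity
      linarith)
    exact ⟨T, by linarith, by nlinarith, by nlinarith, by nlinarith, e⟩
  rcases le_or_gt y (1 / 36) with h₂ | h₂
  · obtain ⟨s, hs0, hs6, hs2, hsy, hf⟩ := f₁_eq h₁ h₂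
    have hx : s * (1 - 2 * s ^ 2) < |x| := by
      rw [← hf]; by_contra! hcon; exact h (Or.inl ⟨hcon, h₁, h₂⟩)
    have hx2 : (s * (1 - 2 * s ^ 2)) ^ 2 < x ^ 2 := by
      rw [← sq_abs x]
      exact pow_lt_pow_left₀ hx (mul_nonneg hs0.le (by linarith)) two_ne_zero
    have e1 : ((s ^ 2) ^ 2 + 3 * y) ^ 2 * ((s ^ 2) ^ 2 + s ^ 2 - 3 * y) =
        4 * (s * (1 - 2 * s ^ 2)) ^ 2 * (s ^ 2) ^ 3 := by
      rw [show 3 * y = s ^ 2 - 3 * s ^ 4 by linarith]; ring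
    have hs3 : 0 < (s ^ 2) ^ 3 := by positivity
    have hlt : ((s ^ 2) ^ 2 + 3 * y) ^ 2 * ((s ^ 2) ^ 2 + s ^ 2 - 3 * y) <
        4 * x ^ 2 * (s ^ 2) ^ 3 := by rw [e1]; nlinarith
    obtain ⟨T, hT, e⟩ := exists_root_ge (x := x) (y := y) (by positivity) hlt.le
    have hT' : s ^ 2 < T := lt_of_le_of_ne hT fun h3 => by rw [← h3] at e; linarith
    have hy3 : 3 * y = s ^ 2 - 3 * (s ^ 2) ^ 2 := by linarith
    set σ := s ^ 2
    refine ⟨T, by linarith, by nlinarith, ?_, by nlinarith, e⟩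
    nlinarith [mul_pos (sub_pos.2 hT') (show 0 < 3 * T + 3 * σ - 1 by linarith)]
  have hy : 0 < y := by linarith
  have hq0 : 0 < √y := Real.sqrt_pos.2 hy
  have hq2 : √y ^ 2 = y := Real.sq_sqrt hy.le
  have hq6 : 1 / 6 < √y := by nlinarith
  -- The discriminant 1 - 36y is now negative.
  have hdisc : ∀ T : ℝ, 0 < 3 * T ^ 2 - T + 3 * y := fun T => by nlinarith [sq_nonneg (6 * T - 1)]
  rcases le_or_gt y (1 / 4) with h₃ | h₃
  · have hq12 : √y ≤ 1 / 2 := by nlinarith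
    have hx : 2 * √y * √(1 - 2 * √y) < |x| := by
      rw [← f₂_eq h₂ h₃]; by_contra! hcon; exact h (Or.inr ⟨hcon, h₂, h₃⟩)
    have hx2 : 4 * √y ^ 2 * (1 - 2 * √y) < x ^ 2 := by
      have := pow_lt_pow_left₀ hx (by positivity) two_ne_zero
      rw [sq_abs, mul_pow, Real.sq_sqrt (by linarith)] at this
      linarith
    set q := √y
    have hlt : (q ^ 2 + 3 * y) ^ 2 * (q ^ 2 + q - 3 * y) < 4 * x ^ 2 * q ^ 3 := by
      have e1 : (q ^ 2 + 3 * y) ^ 2 * (q ^ 2 + q - 3 * y) =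
          4 * (4 * q ^ 2 * (1 - 2 * q)) * q ^ 3 := by rw [← hq2]; ring
      rw [e1]
      have : 0 < q ^ 3 := by positivity
      nlinarith
    obtain ⟨T, hT, e⟩ := exists_root_ge (x := x) (y := y) hq0 hlt.le
    have hT' : q < T := lt_of_le_of_ne hT fun h3 => by rw [← h3] at e; linarith
    exact ⟨T, by linarith, by nlinarith, hdisc T, by nlinarith, e⟩
  · have hr2 : √(1 + 12 * y) ^ 2 = 1 + 12 * y := Real.sq_sqrt (by linarith)
    have hr0 : 0 ≤ √(1 + 12 * y) := Real.sqrt_nonneg _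
    set r := √(1 + 12 * y)
    have hr : 2 < r := by nlinarith
    obtain ⟨T, hT, e⟩ := exists_root_ge (x := x) (y := y) (T₁ := (r - 1) / 2) (by linarith) (by
      rw [show ((r - 1) / 2) ^ 2 + (r - 1) / 2 - 3 * y = 0 by linear_combination hr2 / 4, mul_zero]
      have : 0 < (r - 1) / 2 := by linarith
      positivity)
    have hr4 : r < 1 + 4 * y := by nlinarith
    refine ⟨T, by linarith, ?_, hdisc T, ?_, e⟩
    · nlinarith
    · nlinarith

/-! ### Compact support and the Cauchy transform -/

open Filter Topology in
/-- Exponential moment bounds confine the measure to a compact interval. -/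
theorem ae_abs_le_of_moment_bound {μ : Measure ℝ} [IsProbabilityMeasure μ] {R : ℝ} (hR : 0 < R)
    (hint : ∀ n : ℕ, Integrable (fun u : ℝ => u ^ n) μ)
    (hbound : ∀ n : ℕ, 1 ≤ n → ∫ u, u ^ n ∂μ ≤ R ^ (n + 1)) : ∀ᵐ u ∂μ, |u| ≤ R := by
  have key : ∀ a, R < a → μ {u | a ≤ |u|} = 0 := by
    intro a ha
    have ha0 : 0 < a := hR.trans ha
    -- Markov's inequality for even powers; the bound tends to 0 since a > R.
    have h1 : ∀ n : ℕ, μ.real {u | a ≤ |u|} ≤ R * ((R / a) ^ 2) ^ (n + 1) := by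
      intro n
      have h2 := mul_meas_ge_le_integral_of_nonneg
        (Eventually.of_forall fun u => Even.pow_nonneg (even_two_mul (n + 1)) u)
        (hint (2 * (n + 1))) (a ^ (2 * (n + 1)))
      have h3 : {u : ℝ | a ≤ |u|} ⊆ {u | a ^ (2 * (n + 1)) ≤ u ^ (2 * (n + 1))} := by
        intro u hu
        rw [Set.mem_ofPred_eq, ← Even.pow_abs (even_two_mul (n + 1)) u]
        exact pow_le_pow_left₀ ha0.le hu _
      have h4 := measureReal_mono h3 (measure_ne_top μ _)
      have h5 := hbound (2 * (n + 1)) (by omega)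
      have h6 : (0 : ℝ) < a ^ (2 * (n + 1)) := by positivity
      rw [div_pow, div_pow, ← pow_mul, ← pow_mul, ← mul_div_assoc, le_div_iff₀ h6]
      calc μ.real {u | a ≤ |u|} * a ^ (2 * (n + 1))
          ≤ a ^ (2 * (n + 1)) * μ.real {u | a ^ (2 * (n + 1)) ≤ u ^ (2 * (n + 1))} := by
            rw [mul_comm]; gcongr
        _ ≤ R ^ (2 * (n + 1) + 1) := h2.trans h5
        _ = R * R ^ (2 * (n + 1)) := by ring
    have h7 : Tendsto (fun n : ℕ => R * ((R / a) ^ 2) ^ (n + 1)) atTop (𝓝 (R * 0)) := by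
      refine Tendsto.const_mul _ ((tendsto_add_atTop_iff_nat 1).2
        (tendsto_pow_atTop_nhds_zero_of_lt_one (by positivity) ?_))
      exact pow_lt_one₀ (by positivity) ((div_lt_one ha0).2 ha) two_ne_zero
    rw [mul_zero] at h7
    have h8 := ge_of_tendsto' h7 h1
    exact (measureReal_eq_zero_iff).1 (le_antisymm h8 measureReal_nonneg)
  have h2 : ∀ k : ℕ, ∀ᵐ u ∂μ, |u| < R + 1 / (k + 1) := by
    intro k
    rw [ae_iff]
    simp only [not_lt]
    exact key _ (by have : (0 : ℝ) < 1 / (k + 1) := by positivity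
                    linarith)
  filter_upwards [ae_all_iff.2 h2] with u hu
  refine le_of_forall_pos_lt_add fun ε hε => ?_
  obtain ⟨k, hk⟩ := exists_nat_one_div_lt hε
  exact (hu k).trans (by linarith)

theorem IsFreeCumulantSeq.ae_abs_le {μ : Measure ℝ} [IsProbabilityMeasure μ] {x y : ℝ}
    (h : IsFreeCumulantSeq (cumulantSeq x y) μ) : ∀ᵐ u ∂μ, |u| ≤ 2 + |x| + |y| := by
  refine ae_abs_le_of_moment_bound (by positivity) h.1 fun n hn => ?_
  rw [h.2 n hn]
  exact (le_abs_self _).trans (abs_ncMoment_cumulantSeq_le x y n)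

theorem ncMoment_zero (κ : ℕ → ℝ) : ncMoment κ 0 = 1 := by
  rw [ncMoment_eq_rootedSum, Finset.Ico_self, rootedSum_empty]

theorem IsFreeCumulantSeq.integral_pow {μ : Measure ℝ} [IsProbabilityMeasure μ] {κ : ℕ → ℝ}
    (h : IsFreeCumulantSeq κ μ) (n : ℕ) : ∫ u, u ^ n ∂μ = ncMoment κ n := by
  rcases Nat.eq_zero_or_pos n with rfl | hn
  · simp [ncMoment_zero]
  · exact h.2 n hn

open PowerSeries in
/-- The power series `f` converges absolutely at `t`, with sum `v`. -/
def HasSumAt (t : ℂ) (f : ℝ⟦X⟧) (v : ℂ) : Prop :=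
  Summable (fun n => ‖((coeff n f : ℝ) : ℂ) * t ^ n‖) ∧ ∑' n, ((coeff n f : ℝ) : ℂ) * t ^ n = v

namespace HasSumAt
open PowerSeries

variable {t : ℂ} {f g : ℝ⟦X⟧} {v w : ℂ}

theorem add (hf : HasSumAt t f v) (hg : HasSumAt t g w) : HasSumAt t (f + g) (v + w) := by
  have e : ∀ n, ((coeff n (f + g) : ℝ) : ℂ) * t ^ n =
      ((coeff n f : ℝ) : ℂ) * t ^ n + ((coeff n g : ℝ) : ℂ) * t ^ n := fun n => by
    rw [map_add]; push_cast; ring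
  refine ⟨?_, ?_⟩
  · simp only [e]
    exact (hf.1.add hg.1).of_nonneg_of_le (fun _ => norm_nonneg _) fun n => norm_add_le _ _
  · simp only [e]
    rw [hf.1.of_norm.tsum_add hg.1.of_norm, hf.2, hg.2]

theorem mul (hf : HasSumAt t f v) (hg : HasSumAt t g w) : HasSumAt t (f * g) (v * w) := by
  have e : (fun n => ((coeff n (f * g) : ℝ) : ℂ) * t ^ n) = fun n =>
      ∑ kl ∈ Finset.HasAntidiagonal.antidiagonal n,
        (fun n => ((coeff n f : ℝ) : ℂ) * t ^ n) kl.1 *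
          (fun n => ((coeff n g : ℝ) : ℂ) * t ^ n) kl.2 := by
    funext n
    rw [coeff_mul, Complex.ofReal_sum, Finset.sum_mul]
    refine Finset.sum_congr rfl fun kl hkl => ?_
    rw [← Finset.HasAntidiagonal.mem_antidiagonal.1 hkl, pow_add, Complex.ofReal_mul]
    ring
  have hf' := hf.1
  have hg' := hg.1
  refine ⟨?_, ?_⟩
  · have h := summable_norm_sum_mul_antidiagonal_of_summable_norm hf' hg'
    exact h.congr fun n => by rw [← congrFun e n]
  · have h := tsum_mul_tsum_eq_tsum_sum_antidiagonal_of_summable_norm hf' hg'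
    rw [e, ← h, hf.2, hg.2]

theorem of_support_singleton {n : ℕ} (h : ∀ k, k ≠ n → coeff k f = 0) :
    HasSumAt t f (((coeff n f : ℝ) : ℂ) * t ^ n) := by
  have h' : ∀ k, k ≠ n → ((coeff k f : ℝ) : ℂ) * t ^ k = 0 := fun k hk => by rw [h k hk]; simp
  refine ⟨summable_of_ne_finset_zero (s := {n}) fun k hk => ?_, tsum_eq_single n h'⟩
  rw [h' k (by simpa using hk), norm_zero]

theorem const (a : ℝ) : HasSumAt t (C a) a := by
  have := of_support_singleton (t := t) (f := C a) (n := 0) fun k hk => by rw [coeff_C, if_neg hk]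
  simpa using this

theorem X : HasSumAt t PowerSeries.X t := by
  have := of_support_singleton (t := t) (f := PowerSeries.X) (n := 1)
    fun k hk => by rw [coeff_X, if_neg hk]
  simpa using this

theorem pow (hf : HasSumAt t f v) (n : ℕ) : HasSumAt t (f ^ n) (v ^ n) := by
  induction n with
  | zero => simpa using const (t := t) 1
  | succ n ih => rw [pow_succ, pow_succ]; exact ih.mul hf

theorem unique (hf : HasSumAt t f v) (hf' : HasSumAt t f w) : v = w := hf.2.symm.trans hf'.2

end HasSumAt

/-- The Cauchy transform of `μ` as a function of the inverse `t = 1 / w` of the usual variable. -/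
noncomputable def invCauchy (μ : Measure ℝ) (t : ℂ) : ℂ := ∫ u : ℝ, t / (1 - t * u) ∂μ

section
variable {μ : Measure ℝ} [IsProbabilityMeasure μ] {x y : ℝ}

/-- On the support |tu| ≤ 1/2, so the geometric expansion of t/(1 - tu) may be integrated term by
term. -/
theorem invCauchy_hasSumAt (h : IsFreeCumulantSeq (cumulantSeq x y) μ) {t : ℂ}
    (ht : (2 + |x| + |y|) * ‖t‖ ≤ 1 / 2) :
    ∃ v, HasSumAt t (momentSeries (cumulantSeq x y)) v ∧ invCauchy μ t = t * v ∧
      ‖v‖ ≤ 2 * (2 + |x| + |y|) := by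
  set R := 2 + |x| + |y| with hR
  have hR0 : 0 < R := by positivity
  have hsupp := h.ae_abs_le
  rw [← hR] at hsupp
  set q := R * ‖t‖ with hq
  have hq0 : 0 ≤ q := by positivity
  have hgeo : Summable (fun n : ℕ => q ^ n) := summable_geometric_of_lt_one hq0 (by linarith)
  have hterm : ∀ n, ‖((PowerSeries.coeff n (momentSeries (cumulantSeq x y)) : ℝ) : ℂ) * t ^ n‖ ≤
      R * q ^ n := by
    intro n
    rw [norm_mul, norm_pow, coeff_momentSeries, Complex.norm_real, Real.norm_eq_abs, hq, mul_pow,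
      ← mul_assoc, ← pow_succ']
    exact mul_le_mul_of_nonneg_right (abs_ncMoment_cumulantSeq_le x y n) (by positivity)
  have hsum := (hgeo.mul_left R).of_nonneg_of_le (fun _ => norm_nonneg _) hterm
  refine ⟨_, ⟨hsum, rfl⟩, ?_, ?_⟩
  · have hint : ∀ n : ℕ, Integrable (fun u : ℝ => t ^ (n + 1) * (u : ℂ) ^ n) μ := by
      intro n
      have := ((h.1 n).ofReal (𝕜 := ℂ)).const_mul (t ^ (n + 1))
      simpa using this
    have hnorm : ∀ n : ℕ, ∫ u : ℝ, ‖t ^ (n + 1) * (u : ℂ) ^ n‖ ∂μ ≤ ‖t‖ * q ^ n := by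
      intro n
      have : ∫ u : ℝ, ‖t ^ (n + 1) * (u : ℂ) ^ n‖ ∂μ ≤ ∫ _ : ℝ, ‖t‖ * q ^ n ∂μ := by
        refine integral_mono_ae (hint n).norm (integrable_const _) ?_
        filter_upwards [hsupp] with u hu
        rw [norm_mul, norm_pow, norm_pow, Complex.norm_real, Real.norm_eq_abs, hq, mul_pow, pow_succ']
        have := pow_le_pow_left₀ (abs_nonneg u) hu n
        calc ‖t‖ * ‖t‖ ^ n * |u| ^ n ≤ ‖t‖ * ‖t‖ ^ n * R ^ n := by gcongr
          _ = _ := by ring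
      simpa using this
    have hs2 : Summable fun n : ℕ => ∫ u : ℝ, ‖t ^ (n + 1) * (u : ℂ) ^ n‖ ∂μ :=
      (hgeo.mul_left ‖t‖).of_nonneg_of_le (fun n => integral_nonneg fun _ => norm_nonneg _) hnorm
    have hmain := (hasSum_integral_of_summable_integral_norm hint hs2).tsum_eq
    have e1 : ∫ u : ℝ, (∑' n : ℕ, t ^ (n + 1) * (u : ℂ) ^ n) ∂μ = invCauchy μ t := by
      refine integral_congr_ae ?_
      filter_upwards [hsupp] with u hu
      have htu : ‖t * u‖ < 1 := by
        rw [norm_mul, Complex.norm_real, Real.norm_eq_abs]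
        have := mul_le_mul_of_nonneg_left hu (norm_nonneg t)
        linarith [mul_comm R ‖t‖]
      rw [div_eq_mul_inv, ← tsum_geometric_of_norm_lt_one htu, ← tsum_mul_left]
      exact tsum_congr fun n => by rw [mul_pow]; ring
    rw [← e1, ← hmain, ← tsum_mul_left]
    refine tsum_congr fun n => ?_
    rw [integral_const_mul, coeff_momentSeries, ← h.integral_pow n, ← integral_complex_ofReal]
    push_cast
    ring
  · refine (tsum_of_norm_bounded (hgeo.mul_left R).hasSum hterm).trans ?_
    rw [tsum_mul_left, tsum_geometric_of_lt_one hq0 (by linarith), mul_comm]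
    refine mul_le_mul_of_nonneg_right ?_ hR0.le
    rw [inv_le_comm₀ (by linarith) (by norm_num)]
    linarith

/-- Multiply M = Φ(tM) by t and put g = tM. -/
theorem invCauchy_eq (h : IsFreeCumulantSeq (cumulantSeq x y) μ) {t : ℂ}
    (ht : (2 + |x| + |y|) * ‖t‖ ≤ 1 / 2) :
    invCauchy μ t = t * (1 + invCauchy μ t ^ 2 + x * invCauchy μ t ^ 3 + y * invCauchy μ t ^ 4) ∧
      ‖invCauchy μ t‖ ≤ 2 * (2 + |x| + |y|) * ‖t‖ := by
  obtain ⟨v, hv, hvt, hvn⟩ := invCauchy_hasSumAt h ht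
  have e : HasSumAt t (momentSeries (cumulantSeq x y))
      (1 + t ^ 2 * v ^ 2 + x * t ^ 3 * v ^ 3 + y * t ^ 4 * v ^ 4) := by
    rw [momentSeries_cumulantSeq]
    refine HasSumAt.add (HasSumAt.add (HasSumAt.add ?_ ?_) ?_) ?_
    · simpa using HasSumAt.const (t := t) 1
    · exact (HasSumAt.X.pow 2).mul (hv.pow 2)
    · exact ((HasSumAt.const x).mul (HasSumAt.X.pow 3)).mul (hv.pow 3)
    · exact ((HasSumAt.const y).mul (HasSumAt.X.pow 4)).mul (hv.pow 4)
  have hve := hv.unique e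
  rw [hvt]
  refine ⟨?_, ?_⟩
  · linear_combination t * hve
  · rw [norm_mul, mul_comm]
    exact mul_le_mul_of_nonneg_right hvn (norm_nonneg t)

/-- The conjugate of t times 1 - tu differs from that conjugate by the real number |t|²u. The
resulting lower bound on |1 - tu| is uniform in u. -/
theorem abs_im_le_norm_mul (t : ℂ) (u : ℝ) : |t.im| ≤ ‖t‖ * ‖1 - t * u‖ := by
  have : ‖t‖ * ‖1 - t * u‖ = ‖(starRingEnd ℂ) t * (1 - t * u)‖ := by
    rw [norm_mul, Complex.norm_conj]
  rw [this]
  refine le_trans (le_of_eq ?_) (Complex.abs_im_le_norm _)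
  rw [← abs_neg]
  congr 1
  simp
  ring

theorem differentiableAt_invCauchy (μ : Measure ℝ) [IsProbabilityMeasure μ] {t₀ : ℂ}
    (ht₀ : t₀.im < 0) : DifferentiableAt ℂ (invCauchy μ) t₀ := by
  set δ := -t₀.im / 2 with hδ
  have hδ0 : 0 < δ := by rw [hδ]; linarith
  have him : ∀ t ∈ Metric.ball t₀ δ, δ ≤ |t.im| ∧ ‖t‖ ≤ ‖t₀‖ + δ := by
    intro t ht
    rw [Metric.mem_ball, dist_eq_norm] at ht
    have h1 := (Complex.abs_im_le_norm (t - t₀)).trans ht.le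
    rw [Complex.sub_im] at h1
    refine ⟨?_, ?_⟩
    · have h2 := (abs_le.1 h1).2
      rw [abs_of_neg (by linarith)]; linarith
    · have := norm_add_le t₀ (t - t₀)
      rw [add_sub_cancel] at this
      linarith
  have hne : ∀ t ∈ Metric.ball t₀ δ, ∀ u : ℝ, 1 - t * u ≠ 0 ∧
      ‖1 - t * u‖⁻¹ ≤ (‖t₀‖ + δ) / δ := by
    intro t ht u
    obtain ⟨h1, h2⟩ := him t ht
    have h3 := abs_im_le_norm_mul t u
    have h4 : δ ≤ (‖t₀‖ + δ) * ‖1 - t * u‖ := h1.trans (h3.trans (by gcongr))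
    have h5 : 0 < ‖1 - t * u‖ := by
      rcases (norm_nonneg (1 - t * u)).eq_or_lt with h | h
      · rw [← h, mul_zero] at h4; linarith
      · exact h
    refine ⟨norm_pos_iff.1 h5, ?_⟩
    rw [le_div_iff₀ hδ0, inv_mul_le_iff₀ h5, mul_comm]
    exact h4
  have hmem : t₀ ∈ Metric.ball t₀ δ := Metric.mem_ball_self hδ0
  have hcont : ∀ t ∈ Metric.ball t₀ δ, Continuous fun u : ℝ => t / (1 - t * u) := fun t ht =>
    Continuous.div continuous_const (by fun_prop) fun u => (hne t ht u).1
  refine (hasDerivAt_integral_of_dominated_loc_of_deriv_le (μ := μ) (x₀ := t₀)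
    (s := Metric.ball t₀ δ)
    (F := fun (t : ℂ) (u : ℝ) => t / (1 - t * u)) (F' := fun (t : ℂ) (u : ℝ) => 1 / (1 - t * u) ^ 2)
    (bound := fun _ => ((‖t₀‖ + δ) / δ) ^ 2) (Metric.ball_mem_nhds t₀ hδ0) ?_ ?_ ?_ ?_
    (integrable_const _) ?_).2.differentiableAt
  · filter_upwards [Metric.ball_mem_nhds t₀ hδ0] with t ht
    exact (hcont t ht).aestronglyMeasurable
  · refine Integrable.of_bound (hcont t₀ hmem).aestronglyMeasurable
      (‖t₀‖ * ((‖t₀‖ + δ) / δ)) (Filter.Eventually.of_forall fun u => ?_)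
    rw [norm_div, div_eq_mul_inv]
    exact mul_le_mul_of_nonneg_left (hne t₀ hmem u).2 (norm_nonneg _)
  · exact (Continuous.div continuous_const (by fun_prop) fun u =>
      pow_ne_zero 2 (hne t₀ hmem u).1).aestronglyMeasurable
  · refine Filter.Eventually.of_forall fun u t ht => ?_
    rw [norm_div, norm_one, norm_pow, one_div, ← inv_pow]
    exact pow_le_pow_left₀ (by positivity) (hne t ht u).2 2
  · refine Filter.Eventually.of_forall fun u t ht => ?_
    have h1 : HasDerivAt (fun t : ℂ => 1 - t * u) (-(1 * (u : ℂ))) t :=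
      ((hasDerivAt_id t).mul_const _).const_sub 1
    refine ((hasDerivAt_id t).div h1 (hne t ht u).1).congr_deriv ?_
    simp only [id]
    congr 1
    ring

end

/-! ### Necessity: continuation along a ray to a critical point -/

/-- The complex polynomial function `1 + z² + x z³ + y z⁴`. -/
noncomputable def cumFun (x y : ℝ) (z : ℂ) : ℂ := 1 + z ^ 2 + x * z ^ 3 + y * z ^ 4

theorem continuous_cumFun (x y : ℝ) : Continuous (cumFun x y) := by
  unfold cumFun; fun_prop

open Filter Topology in
theorem eventually_invCauchy_eq {μ : Measure ℝ} [IsProbabilityMeasure μ] {x y : ℝ}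
    (h : IsFreeCumulantSeq (cumulantSeq x y) μ) :
    ∀ᶠ z in 𝓝 (0 : ℂ), invCauchy μ (z / cumFun x y z) = z := by
  set R := 2 + |x| + |y| with hR
  have hΦ0 : cumFun x y 0 = 1 := by simp [cumFun]
  have hΦne : ∀ᶠ z in 𝓝 (0 : ℂ), cumFun x y z ≠ 0 :=
    (continuous_cumFun x y).continuousAt.eventually_ne (by rw [hΦ0]; exact one_ne_zero)
  have ht : Tendsto (fun z => z / cumFun x y z) (𝓝 (0 : ℂ)) (𝓝 0) := by
    have : ContinuousAt (fun z => z / cumFun x y z) 0 :=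
      continuousAt_id.div (continuous_cumFun x y).continuousAt (by rw [hΦ0]; exact one_ne_zero)
    have h1 := this.tendsto
    rwa [zero_div] at h1
  have htn : Tendsto (fun z => ‖z / cumFun x y z‖) (𝓝 (0 : ℂ)) (𝓝 0) := by
    simpa using ht.norm
  have hsmall : ∀ᶠ z in 𝓝 (0 : ℂ), R * ‖z / cumFun x y z‖ ≤ 1 / 2 := by
    have : Tendsto (fun z => R * ‖z / cumFun x y z‖) (𝓝 (0 : ℂ)) (𝓝 0) := by
      simpa using htn.const_mul R
    exact this.eventually_le_const (by norm_num)
  have hg : Tendsto (fun z => invCauchy μ (z / cumFun x y z)) (𝓝 (0 : ℂ)) (𝓝 0) := by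
    refine squeeze_zero_norm' (a := fun z => 2 * R * ‖z / cumFun x y z‖) ?_ ?_
    · filter_upwards [hsmall] with z hz
      exact (invCauchy_eq h hz).2
    · simpa using htn.const_mul (2 * R)
  -- With t = z/Φ(z), both z and g = G(1/t) solve g = tΦ(g). The difference of the two equations
  -- factors as g - z times this bracket, which tends to 1, so small solutions coincide.
  have hbr : Tendsto (fun z => 1 - invCauchy μ (z / cumFun x y z) * z *
      (1 + x * (invCauchy μ (z / cumFun x y z) + z) + y * (invCauchy μ (z / cumFun x y z) ^ 2 +
        invCauchy μ (z / cumFun x y z) * z + z ^ 2))) (𝓝 (0 : ℂ)) (𝓝 1) := by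
    have hz : Tendsto (fun z : ℂ => z) (𝓝 (0 : ℂ)) (𝓝 0) := tendsto_id
    have := ((hg.mul hz).mul ((((hg.add hz).const_mul (x : ℂ)).const_add 1).add
      ((((hg.pow 2).add (hg.mul hz)).add (hz.pow 2)).const_mul (y : ℂ)))).const_sub 1
    simpa using this
  have hbr' := hbr.eventually_ne one_ne_zero
  filter_upwards [hΦne, hsmall, hbr'] with z hz hs hb
  have e := (invCauchy_eq h hs).1
  set g := invCauchy μ (z / cumFun x y z)
  rw [div_mul_eq_mul_div, eq_div_iff hz, cumFun] at e
  have : (g - z) * (1 - g * z * (1 + x * (g + z) + y * (g ^ 2 + g * z + z ^ 2))) = 0 := by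
    linear_combination e
  exact sub_eq_zero.1 ((mul_eq_zero.1 this).resolve_right hb)

/-- The quotient is a positive multiple of z times the conjugate of Φ(z), whose imaginary part is
-r⁵d · `curvePoly`. -/
theorem im_div_cumFun_neg {x y c d r : ℝ} (hcd : c ^ 2 + d ^ 2 = 1) (hd : 0 < d) (hr : 0 < r)
    (hpos : 0 < curvePoly x y c (1 / r)) :
    cumFun x y (r * (c - d * Complex.I)) ≠ 0 ∧
      ((r * (c - d * Complex.I) : ℂ) / cumFun x y (r * (c - d * Complex.I))).im < 0 := by
  set z : ℂ := r * (c - d * Complex.I) with hz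
  have e : (z * (starRingEnd ℂ) (cumFun x y z)).im = -(r ^ 5 * d * curvePoly x y c (1 / r)) := by
    have hz' : (starRingEnd ℂ) z = r * (c + d * Complex.I) := by
      rw [hz]; simp
    have h1 : z * (starRingEnd ℂ) (cumFun x y z) =
        z + (r ^ 2 : ℝ) * (starRingEnd ℂ) z + x * (r ^ 2 : ℝ) * (starRingEnd ℂ) z ^ 2
          + y * (r ^ 2 : ℝ) * (starRingEnd ℂ) z ^ 3 := by
      have h2 : z * (starRingEnd ℂ) z = (r ^ 2 : ℝ) := by
        rw [hz', hz]
        have : (c : ℂ) ^ 2 + (d : ℂ) ^ 2 = 1 := by exact_mod_cast hcd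
        push_cast
        linear_combination (r : ℂ) ^ 2 * this - (r : ℂ) ^ 2 * (d : ℂ) ^ 2 * Complex.I_sq
      rw [cumFun, ← h2]
      simp only [map_add, map_mul, map_pow, map_one, Complex.conj_ofReal]
      ring
    have hI3 : (c + d * Complex.I) ^ 3 = ((c ^ 3 - 3 * c * d ^ 2 : ℝ) : ℂ)
        + ((3 * c ^ 2 * d - d ^ 3 : ℝ) : ℂ) * Complex.I := by
      push_cast
      linear_combination (3 * (c : ℂ) * d ^ 2 + d ^ 3 * Complex.I) * Complex.I_sq
    have hI2 : (c + d * Complex.I) ^ 2 = ((c ^ 2 - d ^ 2 : ℝ) : ℂ)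
        + ((2 * c * d : ℝ) : ℂ) * Complex.I := by
      push_cast
      linear_combination (d : ℂ) ^ 2 * Complex.I_sq
    have h3 : z * (starRingEnd ℂ) (cumFun x y z) =
        ((r * c + r ^ 2 * (r * c) + x * r ^ 2 * (r ^ 2 * (c ^ 2 - d ^ 2))
          + y * r ^ 2 * (r ^ 3 * (c ^ 3 - 3 * c * d ^ 2)) : ℝ) : ℂ) +
        ((-(r * d) + r ^ 2 * (r * d) + x * r ^ 2 * (r ^ 2 * (2 * c * d))
          + y * r ^ 2 * (r ^ 3 * (3 * c ^ 2 * d - d ^ 3)) : ℝ) : ℂ) * Complex.I := by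
      rw [h1, hz', mul_pow, mul_pow, hI2, hI3, hz]
      push_cast
      ring
    rw [h3]
    simp only [Complex.add_im, Complex.ofReal_im, Complex.mul_im, Complex.ofReal_re,
      Complex.I_re, Complex.I_im]
    rw [curvePoly, show d ^ 3 = d * (1 - c ^ 2) by rw [← hcd]; ring]
    field_simp
    ring
  have hneg : (z * (starRingEnd ℂ) (cumFun x y z)).im < 0 := by
    rw [e]
    have : 0 < r ^ 5 * d * curvePoly x y c (1 / r) := by positivity
    linarith
  have hne : cumFun x y z ≠ 0 := by
    intro h0
    rw [h0] at hneg
    simp at hneg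
  refine ⟨hne, ?_⟩
  have h4 : z / cumFun x y z =
      ((Complex.normSq (cumFun x y z))⁻¹ : ℝ) * (z * (starRingEnd ℂ) (cumFun x y z)) := by
    rw [div_eq_mul_inv, Complex.inv_def]; ring
  rw [h4, Complex.im_ofReal_mul]
  exact mul_neg_of_pos_of_neg (inv_pos.2 (Complex.normSq_pos.2 hne)) hneg

theorem exists_critical_ray {x y T : ℝ} (hT : 1 / 6 ≤ T)
    (h₂ : 0 < 3 * T ^ 2 - T + 3 * y) (h₃ : 0 ≤ T ^ 2 + T - 3 * y)
    (h₄ : (T ^ 2 + 3 * y) ^ 2 * (T ^ 2 + T - 3 * y) = 4 * x ^ 2 * T ^ 3) :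
    ∃ s₀ c d : ℝ, 0 < s₀ ∧ s₀ ^ 2 = T ∧ 0 < d ∧ c ^ 2 + d ^ 2 = 1 ∧
      c * (T ^ 2 + 3 * y) = -(x * s₀) ∧ 4 * T ^ 2 * c ^ 2 = T ^ 2 + T - 3 * y := by
  have hT0 : 0 < T := by linarith
  have hs : √T ^ 2 = T := Real.sq_sqrt hT0.le
  have hs0 : 0 < √T := Real.sqrt_pos.2 hT0
  obtain ⟨c, hc1, hc2⟩ : ∃ c : ℝ, c * (T ^ 2 + 3 * y) = -(x * √T) ∧
      4 * T ^ 2 * c ^ 2 = T ^ 2 + T - 3 * y := by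
    -- If T² + 3y = 0 then x = 0 and the linear equation leaves c free; the quadratic one determines
    -- c².
    by_cases h0 : T ^ 2 + 3 * y = 0
    · have hx : x = 0 := by
        rw [h0] at h₄
        have : x ^ 2 * T ^ 3 = 0 := by linarith
        rcases mul_eq_zero.1 this with h | h
        · exact pow_eq_zero_iff two_ne_zero |>.1 h
        · exact absurd h (by positivity)
      refine ⟨√((T ^ 2 + T - 3 * y) / (4 * T ^ 2)), by rw [h0, hx]; ring, ?_⟩
      rw [Real.sq_sqrt (by positivity)]
      field_simp
    · refine ⟨-(x * √T) / (T ^ 2 + 3 * y), by field_simp, ?_⟩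
      rw [div_pow, neg_sq, mul_pow, hs, mul_div_assoc', div_eq_iff (pow_ne_zero 2 h0)]
      linear_combination -h₄
  have hc : c ^ 2 < 1 := by
    by_contra! hcon
    have := mul_le_mul_of_nonneg_left hcon (by positivity : 0 ≤ 4 * T ^ 2)
    nlinarith
  exact ⟨√T, c, √(1 - c ^ 2), hs0, hs, Real.sqrt_pos.2 (by linarith), by
    rw [Real.sq_sqrt (by linarith)]; ring, hc1, hc2⟩

/-- Taylor expansion at s₀: value and slope there are positive multiples of (T² - y)(3T² - T + 3y)
with T = s₀², and the second-order coefficient 6s₀² - 1 is nonnegative because s₀² ≥ 1/6. -/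
theorem curvePoly_pos_of_ge {x y s₀ c s : ℝ} (hs₀ : 0 < s₀) (hT : 1 / 6 ≤ s₀ ^ 2)
    (h₁ : y < (s₀ ^ 2) ^ 2) (h₂ : 0 < 3 * (s₀ ^ 2) ^ 2 - s₀ ^ 2 + 3 * y)
    (hc1 : c * ((s₀ ^ 2) ^ 2 + 3 * y) = -(x * s₀))
    (hc2 : 4 * (s₀ ^ 2) ^ 2 * c ^ 2 = (s₀ ^ 2) ^ 2 + s₀ ^ 2 - 3 * y) (hs : s₀ ≤ s) :
    0 < curvePoly x y c s := by
  have hP : 0 < ((s₀ ^ 2) ^ 2 - y) * (3 * (s₀ ^ 2) ^ 2 - s₀ ^ 2 + 3 * y) :=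
    mul_pos (by linarith) h₂
  have e0 : 2 * (s₀ ^ 2) ^ 2 * curvePoly x y c s₀ =
      ((s₀ ^ 2) ^ 2 - y) * (3 * (s₀ ^ 2) ^ 2 - s₀ ^ 2 + 3 * y) := by
    rw [curvePoly]
    linear_combination 4 * (s₀ ^ 2) ^ 2 * (-c) * hc1 + ((s₀ ^ 2) ^ 2 + y) * hc2
  have e1 : 2 * (s₀ ^ 2) ^ 2 * (s₀ * (4 * s₀ ^ 3 - 2 * s₀ - 2 * x * c)) =
      3 * (((s₀ ^ 2) ^ 2 - y) * (3 * (s₀ ^ 2) ^ 2 - s₀ ^ 2 + 3 * y)) := by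
    linear_combination 4 * (s₀ ^ 2) ^ 2 * (-c) * hc1 + ((s₀ ^ 2) ^ 2 + 3 * y) * hc2
  have g0 : 0 < curvePoly x y c s₀ := by
    have : 0 < 2 * (s₀ ^ 2) ^ 2 * curvePoly x y c s₀ := by rw [e0]; exact hP
    exact (pos_iff_pos_of_mul_pos this).1 (by positivity)
  have g1 : 0 < 4 * s₀ ^ 3 - 2 * s₀ - 2 * x * c := by
    have : 0 < 2 * (s₀ ^ 2) ^ 2 * (s₀ * (4 * s₀ ^ 3 - 2 * s₀ - 2 * x * c)) := by
      rw [e1]; positivity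
    rw [← mul_assoc] at this
    exact (pos_iff_pos_of_mul_pos this).1 (by positivity)
  have e : curvePoly x y c s = curvePoly x y c s₀ + (4 * s₀ ^ 3 - 2 * s₀ - 2 * x * c) * (s - s₀)
      + (6 * s₀ ^ 2 - 1) * (s - s₀) ^ 2 + 4 * s₀ * (s - s₀) ^ 3 + (s - s₀) ^ 4 := by
    unfold curvePoly; ring
  have h0 : 0 ≤ s - s₀ := by linarith
  have h6 : 0 ≤ 6 * s₀ ^ 2 - 1 := by linarith
  rw [e]
  positivity

open Filter Topology in
/-- The inverse of the Cauchy transform has no critical point that can be reached along a ray. -/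
theorem deriv_ne_zero_of_ray {μ : Measure ℝ} [IsProbabilityMeasure μ] {x y : ℝ}
    (h : IsFreeCumulantSeq (cumulantSeq x y) μ) {c d r₀ : ℝ} (hcd : c ^ 2 + d ^ 2 = 1)
    (hd : 0 < d) (hr₀ : 0 < r₀)
    (hpos : ∀ r, 0 < r → r ≤ r₀ → 0 < curvePoly x y c (1 / r)) :
    deriv (fun z => z / cumFun x y z) (r₀ * (c - d * Complex.I)) ≠ 0 := by
  intro hcrit
  set e : ℂ := c - d * Complex.I with he
  have he0 : e ≠ 0 := by
    intro h0
    have := congrArg Complex.im h0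
    simp [he] at this
    exact hd.ne' this
  set t : ℂ → ℂ := fun z => z / cumFun x y z with ht
  -- The endpoint is included: the identity must hold at the critical point itself. `U` is not open,
  -- but connectedness and analyticity at each of its points suffice for the identity theorem.
  set U : Set ℂ := (fun r : ℝ => (r : ℂ) * e) '' Set.Ioc 0 r₀ with hU
  have hUprop : ∀ z ∈ U, cumFun x y z ≠ 0 ∧ (t z).im < 0 := by
    rintro _ ⟨r, hr, rfl⟩
    exact im_div_cumFun_neg hcd hd hr.1 (hpos r hr.1 hr.2)
  have hUpre : IsPreconnected U :=
    isPreconnected_Ioc.image _ (by fun_prop)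
  have hGan : AnalyticOnNhd ℂ (invCauchy μ) {t | t.im < 0} :=
    DifferentiableOn.analyticOnNhd
      (fun t ht => (differentiableAt_invCauchy μ ht).differentiableWithinAt)
      (isOpen_lt Complex.continuous_im continuous_const)
  have htan : AnalyticOnNhd ℂ t U := fun z hz => by
    refine analyticAt_id.div ?_ (hUprop z hz).1
    unfold cumFun
    fun_prop
  have hFan : AnalyticOnNhd ℂ (fun z => invCauchy μ (t z)) U := fun z hz =>
    (hGan (t z) (hUprop z hz).2).comp (htan z hz)
  obtain ⟨z₁, hz₁, hloc⟩ : ∃ z₁ ∈ U, (fun z => invCauchy μ (t z)) =ᶠ[𝓝 z₁] fun z => z := by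
    have h1 := eventually_eventually_nhds.2 (eventually_invCauchy_eq h)
    have h2 : Tendsto (fun r : ℝ => (r : ℂ) * e) (𝓝[>] 0) (𝓝 0) := by
      have : Continuous fun r : ℝ => (r : ℂ) * e := by fun_prop
      have h3 := this.tendsto 0
      simp only [Complex.ofReal_zero, zero_mul] at h3
      exact h3.mono_left nhdsWithin_le_nhds
    obtain ⟨r, hr, hr'⟩ := ((h2.eventually h1).and (Ioc_mem_nhdsGT hr₀)).exists
    exact ⟨_, ⟨r, hr', rfl⟩, hr⟩
  have hEq := hFan.eqOn_of_preconnected_of_eventuallyEq (fun z _ => analyticAt_id) hUpre hz₁ hloc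
  have hz₀ : (r₀ : ℂ) * e ∈ U := ⟨r₀, ⟨hr₀, le_rfl⟩, rfl⟩
  have hF' : HasDerivAt (fun z => invCauchy μ (t z)) 0 ((r₀ : ℂ) * e) := by
    have h1 := (hGan _ (hUprop _ hz₀).2).differentiableAt.hasDerivAt
    have h2 := (htan _ hz₀).differentiableAt.hasDerivAt
    rw [hcrit] at h2
    have h3 := h1.comp _ h2
    rwa [mul_zero] at h3
  have hline : HasDerivAt (fun r : ℝ => (r : ℂ) * e) e r₀ := by
    simpa using (Complex.ofRealCLM.hasDerivAt (x := r₀)).mul_const e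
  have h3 : HasDerivAt (fun r : ℝ => invCauchy μ (t ((r : ℂ) * e))) 0 r₀ := by
    have h5 := HasDerivAt.comp (h₂ := fun z => invCauchy μ (t z)) r₀ hF' hline
    rwa [zero_mul] at h5
  -- The identity is known only on the ray, so derivatives at the endpoint are compared from one
  -- side; they would be 0 and `e`.
  have h4 : HasDerivWithinAt (fun r : ℝ => (r : ℂ) * e) 0 (Set.Ioc 0 r₀) r₀ :=
    h3.hasDerivWithinAt.congr (fun r hr => (hEq ⟨r, hr, rfl⟩).symm) (hEq hz₀).symm
  have hu : UniqueDiffWithinAt ℝ (Set.Ioc 0 r₀) r₀ :=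
    uniqueDiffOn_Ioc 0 r₀ r₀ ⟨hr₀, le_rfl⟩
  exact he0 (hu.eq_deriv _ hline.hasDerivWithinAt h4)

theorem IsRealizable.mem_regionD {x y : ℝ} (h : IsRealizable (cumulantSeq x y)) :
    (x, y) ∈ regionD := by
  by_contra hD
  obtain ⟨μ, hμ, hκ⟩ := h
  obtain ⟨T, hT, h₁, h₂, h₃, h₄⟩ := exists_critical_modulus hD
  obtain ⟨s₀, c, d, hs₀, rfl, hd, hcd, hc1, hc2⟩ := exists_critical_ray hT h₂ h₃ h₄
  have hpos : ∀ r, 0 < r → r ≤ 1 / s₀ → 0 < curvePoly x y c (1 / r) := fun r hr hr' =>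
    curvePoly_pos_of_ge hs₀ hT h₁ h₂ hc1 hc2 (by rwa [le_div_comm₀ hs₀ hr])
  refine deriv_ne_zero_of_ray hκ hcd hd (by positivity : 0 < 1 / s₀) hpos ?_
  have hne := (im_div_cumFun_neg hcd hd (by positivity : 0 < 1 / s₀) (hpos _ (by positivity) le_rfl)).1
  set z : ℂ := ((1 / s₀ : ℝ) : ℂ) * (c - d * Complex.I) with hz
  have hder : HasDerivAt (cumFun x y) (2 * z + x * (3 * z ^ 2) + y * (4 * z ^ 3)) z := by
    have := (((hasDerivAt_pow 2 z).const_add 1).add ((hasDerivAt_pow 3 z).const_mul (x : ℂ))).add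
      ((hasDerivAt_pow 4 z).const_mul (y : ℂ))
    refine this.congr_deriv ?_
    norm_num
  rw [((hasDerivAt_id' z).fun_div hder hne).deriv]
  have hs₀' : (s₀ : ℂ) ≠ 0 := by exact_mod_cast hs₀.ne'
  -- The real quadratic whose roots are z and its conjugate; reducing modulo it yields the critical
  -- equation.
  have hquad : (s₀ : ℂ) ^ 2 * z ^ 2 = 2 * c * s₀ * z - 1 := by
    have hcd' : (c : ℂ) ^ 2 + (d : ℂ) ^ 2 = 1 := by exact_mod_cast hcd
    rw [hz]
    push_cast
    field_simp
    linear_combination -hcd' + (d : ℂ) ^ 2 * Complex.I_sq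
  have hc1' : (c : ℂ) * (((s₀ : ℂ) ^ 2) ^ 2 + 3 * y) = -(x * s₀) := by exact_mod_cast hc1
  have hc2' : 4 * ((s₀ : ℂ) ^ 2) ^ 2 * (c : ℂ) ^ 2 = ((s₀ : ℂ) ^ 2) ^ 2 + (s₀ : ℂ) ^ 2 - 3 * y := by
    exact_mod_cast hc2
  have hnum : 1 - z ^ 2 - 2 * x * z ^ 3 - 3 * y * z ^ 4 = 0 := by
    have h0 : (s₀ : ℂ) ^ 2 * (1 - z ^ 2 - 2 * x * z ^ 3 - 3 * y * z ^ 4) = 0 := by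
      linear_combination (s₀ ^ 2 + 2 * c * s₀ * s₀ ^ 2 * z - 3 * y * z ^ 2) * hquad
        + z ^ 2 * hc2' - 2 * s₀ * z ^ 3 * hc1'
    exact (mul_eq_zero.1 h0).resolve_left (pow_ne_zero 2 hs₀')
  rw [div_eq_zero_iff]
  left
  rw [cumFun]
  linear_combination hnum

/-! ### Sufficiency: a density on the curve where K is real -/

open scoped Real in
/-- A nonnegative continuous weight on `[0, π]`, transported by a continuous function. -/
theorem exists_measure_of_density {u w : ℝ → ℝ} (hu : Continuous u) (hw : Continuous w)
    (hw0 : ∀ θ ∈ Set.Ioc 0 π, 0 ≤ w θ) {m : ℕ → ℝ} (hm0 : m 0 = 1)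
    (hm : ∀ n : ℕ, ∫ θ in (0 : ℝ)..π, w θ * u θ ^ n = m n) :
    ∃ μ : Measure ℝ, IsProbabilityMeasure μ ∧ (∀ n : ℕ, Integrable (fun t : ℝ => t ^ n) μ) ∧
      ∀ n : ℕ, ∫ t, t ^ n ∂μ = m n := by
  set ν : Measure ℝ := volume.restrict (Set.Ioc 0 π) with hν
  have hint : ∀ n : ℕ, Integrable (fun θ => w θ * u θ ^ n) ν := fun n =>
    ((hw.mul (hu.pow n)).intervalIntegrable 0 π).1
  have hwint : Integrable w ν := (hw.intervalIntegrable 0 π).1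
  set ρ : Measure ℝ := ν.withDensity (fun θ => ENNReal.ofReal (w θ)) with hρ
  have hfin : IsFiniteMeasure ρ := isFiniteMeasure_withDensity_ofReal hwint.2
  have hwm : Measurable fun θ => ENNReal.ofReal (w θ) := hw.measurable.ennreal_ofReal
  have hw0' : ∀ᵐ θ ∂ν, 0 ≤ w θ := (ae_restrict_iff' measurableSet_Ioc).2
    (Filter.Eventually.of_forall hw0)
  have hpow : ∀ n : ℕ, Integrable (fun θ => u θ ^ n) ρ := by
    intro n
    rw [hρ, integrable_withDensity_iff_integrable_smul' hwm
      (Filter.Eventually.of_forall fun _ => ENNReal.ofReal_lt_top)]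
    refine (hint n).congr ?_
    filter_upwards [hw0'] with θ hθ
    rw [ENNReal.toReal_ofReal hθ, smul_eq_mul]
  have hval : ∀ n : ℕ, ∫ θ, u θ ^ n ∂ρ = m n := by
    intro n
    rw [hρ, integral_withDensity_eq_integral_toReal_smul hwm
      (Filter.Eventually.of_forall fun _ => ENNReal.ofReal_lt_top), ← hm n,
      intervalIntegral.integral_of_le Real.pi_pos.le]
    refine integral_congr_ae ?_
    filter_upwards [hw0'] with θ hθ
    rw [ENNReal.toReal_ofReal hθ, smul_eq_mul]
  have hmap : ∀ n : ℕ, ∫ t, t ^ n ∂(ρ.map u) = m n := by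
    intro n
    rw [integral_map hu.measurable.aemeasurable (by fun_prop), hval n]
  refine ⟨ρ.map u, ?_, ?_, hmap⟩
  · have h0 := hmap 0
    simp only [pow_zero, integral_const, smul_eq_mul, mul_one, hm0] at h0
    have : IsFiniteMeasure (ρ.map u) := Measure.isFiniteMeasure_map ρ u
    refine ⟨?_⟩
    rw [measureReal_def] at h0
    rw [← ENNReal.ofReal_toReal (measure_ne_top (ρ.map u) Set.univ), h0, ENNReal.ofReal_one]
  · intro n
    rw [integrable_map_measure (by fun_prop) hu.measurable.aemeasurable]
    exact hpow n

/-- The bound M is uniform in c, which the continuity estimate for the chosen root requires. -/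
theorem exists_curve_root {x y s₀ : ℝ} (hs₀ : 0 < s₀)
    (hneg : ∀ c : ℝ, |c| ≤ 1 → curvePoly x y c s₀ < 0) :
    ∃ M : ℝ, ∀ c : ℝ, |c| ≤ 1 → ∃ s, s₀ < s ∧ s ≤ M ∧ curvePoly x y c s = 0 := by
  set M := s₀ + 2 + 2 * |x| + 3 * |y| with hM
  refine ⟨M, fun c hc => ?_⟩
  have hx0 := abs_nonneg x
  have hy0 := abs_nonneg y
  have hpos : 0 ≤ curvePoly x y c M := by
    have h1 : 1 ≤ M := by linarith
    have hxc : x * c ≤ |x| := by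
      refine (le_abs_self _).trans ?_
      rw [abs_mul]; exact mul_le_of_le_one_right hx0 hc
    have hc2 : c ^ 2 ≤ 1 := (sq_le_one_iff_abs_le_one c).2 hc
    have hyc : y * (4 * c ^ 2 - 1) ≤ 3 * |y| := by
      refine (le_abs_self _).trans ?_
      rw [abs_mul, mul_comm]
      refine mul_le_mul_of_nonneg_right ?_ hy0
      rw [abs_le]
      constructor <;> nlinarith [sq_nonneg c]
    have hM2 : M ≤ M ^ 2 := by nlinarith
    have h2 : x * c * M ≤ |x| * M ^ 2 :=
      (mul_le_mul_of_nonneg_right hxc (by linarith)).trans (mul_le_mul_of_nonneg_left hM2 hx0)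
    have h3 : 3 * |y| ≤ 3 * |y| * M ^ 2 := le_mul_of_one_le_right (by positivity) (by linarith)
    have h4 : 0 ≤ M ^ 2 * (M ^ 2 - 1 - 2 * |x| - 3 * |y|) :=
      mul_nonneg (by positivity) (by linarith)
    rw [curvePoly]
    nlinarith
  obtain ⟨s, hs, h0⟩ := intermediate_value_Icc (show s₀ ≤ M by linarith)
    (f := fun s => curvePoly x y c s) (by unfold curvePoly; fun_prop)
    (show (0 : ℝ) ∈ _ from ⟨(hneg c hc).le, hpos⟩)
  refine ⟨s, lt_of_le_of_ne hs.1 ?_, hs.2, h0⟩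
  rintro rfl
  exact (hneg c hc).ne h0

/-- The slope of the chord of `curvePoly x y c` between `s` and `s'`. -/
def chordSlope (x c s s' : ℝ) : ℝ := (s + s') * (s ^ 2 + s' ^ 2) - (s + s') - 2 * x * c

/-- The difference of the two slopes contains six quadratic products, each at least s₀² ≥ 1/6, so
their sum is at least 1. -/
theorem chordSlope_pos {x y c s₀ s s' : ℝ} (hs₀ : 0 < s₀) (h6 : 1 / 6 ≤ s₀ ^ 2)
    (hneg : curvePoly x y c s₀ < 0) (hs : s₀ < s) (hs' : s₀ ≤ s') (h0 : curvePoly x y c s = 0) :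
    0 < chordSlope x c s s₀ ∧ chordSlope x c s s₀ ≤ chordSlope x c s s' := by
  constructor
  · have : 0 < (s - s₀) * chordSlope x c s s₀ := by
      have e : (s - s₀) * chordSlope x c s s₀ = curvePoly x y c s - curvePoly x y c s₀ := by
        unfold chordSlope curvePoly; ring
      rw [e, h0]; linarith
    exact (pos_iff_pos_of_mul_pos this).1 (by linarith)
  · have e : chordSlope x c s s' - chordSlope x c s s₀ =
        (s' - s₀) * (s ^ 2 + s * (s' + s₀) + s' ^ 2 + s' * s₀ + s₀ ^ 2 - 1) := by
      unfold chordSlope; ring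
    have h1 : 0 ≤ s ^ 2 + s * (s' + s₀) + s' ^ 2 + s' * s₀ + s₀ ^ 2 - 1 := by nlinarith
    have := mul_nonneg (sub_nonneg.2 hs') h1
    linarith

open Filter Topology in
-- A direct implicit function argument: subtracting the equations at θ and θ₀ expresses S θ - S θ₀
-- exactly through the cosine increment. The chord slope is bounded below by a positive constant, so
-- an arbitrary choice of roots is continuous, then differentiable.
theorem hasDerivAt_curve_root {x y s₀ M : ℝ} (hs₀ : 0 < s₀) (h6 : 1 / 6 ≤ s₀ ^ 2)
    (hneg : ∀ c : ℝ, |c| ≤ 1 → curvePoly x y c s₀ < 0) {S : ℝ → ℝ}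
    (hS : ∀ θ, s₀ < S θ ∧ S θ ≤ M ∧ curvePoly x y (Real.cos θ) (S θ) = 0) (θ₀ : ℝ) :
    HasDerivAt S (Real.sin θ₀ * (-2 * x * S θ₀ - 8 * y * Real.cos θ₀) /
      chordSlope x (Real.cos θ₀) (S θ₀) (S θ₀)) θ₀ := by
  set α := chordSlope x (Real.cos θ₀) (S θ₀) s₀ with hα
  have hchord : ∀ θ, 0 < α ∧ α ≤ chordSlope x (Real.cos θ₀) (S θ₀) (S θ) := fun θ =>
    chordSlope_pos hs₀ h6 (hneg _ (Real.abs_cos_le_one _)) (hS θ₀).1 (hS θ).1.le (hS θ₀).2.2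
  have hα0 := (hchord θ₀).1
  have heq : ∀ θ, S θ - S θ₀ = -(Real.cos θ - Real.cos θ₀) *
      ((-2 * x * S θ - 4 * y * (Real.cos θ₀ + Real.cos θ)) /
        chordSlope x (Real.cos θ₀) (S θ₀) (S θ)) := by
    intro θ
    have hA : chordSlope x (Real.cos θ₀) (S θ₀) (S θ) ≠ 0 :=
      (hα0.trans_le (hchord θ).2).ne'
    have h1 := (hS θ).2.2
    have h2 := (hS θ₀).2.2
    rw [mul_div_assoc', eq_div_iff hA]
    unfold chordSlope
    unfold curvePoly at h1 h2
    linear_combination h1 - h2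
  have hM : 0 ≤ M := hs₀.le.trans ((hS 0).1.le.trans (hS 0).2.1)
  have hcont : ContinuousAt S θ₀ := by
    rw [ContinuousAt, tendsto_iff_norm_sub_tendsto_zero]
    have hb : ∀ θ, ‖S θ - S θ₀‖ ≤
        |Real.cos θ - Real.cos θ₀| * ((2 * |x| * M + 8 * |y|) / α) := by
      intro θ
      rw [heq θ, Real.norm_eq_abs, abs_mul, abs_neg, abs_div]
      refine mul_le_mul_of_nonneg_left ?_ (abs_nonneg _)
      rw [abs_of_pos (hα0.trans_le (hchord θ).2)]
      refine div_le_div₀ (by positivity) ?_ hα0 (hchord θ).2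
      refine (abs_sub _ _).trans (add_le_add ?_ ?_)
      · rw [abs_mul, abs_mul, abs_neg, abs_two, abs_of_pos (hs₀.trans (hS θ).1)]
        exact mul_le_mul_of_nonneg_left (hS θ).2.1 (by positivity)
      · rw [abs_mul, abs_mul, abs_of_pos (by norm_num : (0 : ℝ) < 4)]
        have h1 := (abs_add_le (Real.cos θ₀) (Real.cos θ)).trans
          (add_le_add (Real.abs_cos_le_one _) (Real.abs_cos_le_one _))
        have := mul_le_mul_of_nonneg_left h1 (by positivity : 0 ≤ 4 * |y|)
        linarith
    refine squeeze_zero (fun _ => norm_nonneg _) hb ?_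
    have : ContinuousAt (fun θ => |Real.cos θ - Real.cos θ₀| * ((2 * |x| * M + 8 * |y|) / α)) θ₀ := by
      fun_prop
    have h2 := this.tendsto
    simpa using h2
  rw [hasDerivAt_iff_tendsto_slope]
  have hcos := (hasDerivAt_iff_tendsto_slope.1 (Real.hasDerivAt_cos θ₀))
  have hk : ContinuousAt (fun θ => (-2 * x * S θ - 4 * y * (Real.cos θ₀ + Real.cos θ)) /
        chordSlope x (Real.cos θ₀) (S θ₀) (S θ)) θ₀ := by
    refine ContinuousAt.div (by fun_prop) ?_ (hα0.trans_le (hchord θ₀).2).ne'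
    unfold chordSlope
    fun_prop
  have hk' := hk.tendsto.mono_left (nhdsWithin_le_nhds (s := {θ₀}ᶜ))
  have := (hcos.mul hk').neg
  have e : Real.sin θ₀ * (-2 * x * S θ₀ - 8 * y * Real.cos θ₀) /
      chordSlope x (Real.cos θ₀) (S θ₀) (S θ₀) = -(-Real.sin θ₀ *
        ((-2 * x * S θ₀ - 4 * y * (Real.cos θ₀ + Real.cos θ₀)) /
          chordSlope x (Real.cos θ₀) (S θ₀) (S θ₀))) := by ring
  rw [e]
  refine this.congr fun θ => ?_
  rw [slope_def_field, slope_def_field, heq θ]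
  ring

/-- The point `exp (i θ) / S θ` of the curve with inverse radius `S`. -/
noncomputable def curvePt (S : ℝ → ℝ) (θ : ℝ) : ℂ :=
  (Real.cos θ + Real.sin θ * Complex.I) / S θ

/-- The value of `1/z + z + x z² + y z³` at the point `curvePt S θ`, when it is real. -/
noncomputable def curveVal (x y : ℝ) (S : ℝ → ℝ) (θ : ℝ) : ℝ :=
  (S θ + 1 / S θ) * Real.cos θ + x * (2 * Real.cos θ ^ 2 - 1) / S θ ^ 2
    + y * (4 * Real.cos θ ^ 3 - 3 * Real.cos θ) / S θ ^ 3

theorem sq_sin_ofReal (θ : ℝ) : ((Real.sin θ : ℝ) : ℂ) ^ 2 = 1 - ((Real.cos θ : ℝ) : ℂ) ^ 2 := by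
  exact_mod_cast (Real.sin_sq θ)

theorem curvePt_ne_zero {S : ℝ → ℝ} {θ : ℝ} (hS : S θ ≠ 0) : curvePt S θ ≠ 0 := by
  rw [curvePt]
  refine div_ne_zero (fun h => ?_) (by exact_mod_cast hS)
  have h1 : ((Real.cos θ : ℝ) + (Real.sin θ : ℝ) * Complex.I : ℂ) *
      ((Real.cos θ : ℝ) - (Real.sin θ : ℝ) * Complex.I) = 1 := by
    linear_combination sq_sin_ofReal θ - ((Real.sin θ : ℝ) : ℂ) ^ 2 * Complex.I_sq
  rw [h, zero_mul] at h1
  exact zero_ne_one h1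

theorem inv_curvePt {S : ℝ → ℝ} {θ : ℝ} (hS : S θ ≠ 0) :
    (curvePt S θ)⁻¹ = S θ * ((Real.cos θ : ℝ) - (Real.sin θ : ℝ) * Complex.I) := by
  have hS' : (S θ : ℂ) ≠ 0 := by exact_mod_cast hS
  refine inv_eq_of_mul_eq_one_right ?_
  rw [curvePt]
  field_simp
  linear_combination sq_sin_ofReal θ - ((Real.sin θ : ℝ) : ℂ) ^ 2 * Complex.I_sq

/-- The function `1/z + z + x z² + y z³`. -/
noncomputable def invTransform (x y : ℝ) (z : ℂ) : ℂ := z⁻¹ + z + x * z ^ 2 + y * z ^ 3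

theorem invTransform_curvePt {x y : ℝ} {S : ℝ → ℝ} {θ : ℝ} (hS : S θ ≠ 0)
    (h0 : curvePoly x y (Real.cos θ) (S θ) = 0) :
    invTransform x y (curvePt S θ) = curveVal x y S θ := by
  have hS' : (S θ : ℂ) ≠ 0 := by exact_mod_cast hS
  have h0' : (S θ : ℂ) ^ 4 - (S θ : ℂ) ^ 2 - 2 * x * (Real.cos θ : ℝ) * S θ
      - y * (4 * ((Real.cos θ : ℝ) : ℂ) ^ 2 - 1) = 0 := by
    rw [curvePoly] at h0; exact_mod_cast h0
  have hs := sq_sin_ofReal θ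
  rw [invTransform, inv_curvePt hS, curvePt, curveVal]
  push_cast
  set c : ℂ := ((Real.cos θ : ℝ) : ℂ) with hc
  set d : ℂ := ((Real.sin θ : ℝ) : ℂ) with hd
  rw [← Complex.ofReal_cos, ← Complex.ofReal_sin, ← hc, ← hd]
  field_simp
  have hI := Complex.I_sq
  have hI3 : Complex.I ^ 3 = -Complex.I := by linear_combination Complex.I * hI
  have hd3 : d ^ 3 = d * (1 - c ^ 2) := by linear_combination d * hs
  linear_combination -(d * Complex.I) * h0' + (x * S θ * d ^ 2 + 3 * y * c * d ^ 2) * hI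
    + y * d ^ 3 * hI3 - y * Complex.I * hd3 - (x * S θ + 3 * y * c) * hs

/-- The imaginary part of `z K'(z)` at `z = curvePt S θ`, where `K = invTransform x y`. -/
theorem im_deriv_curvePt {x y : ℝ} {S : ℝ → ℝ} {θ : ℝ} (hS : S θ ≠ 0)
    (h0 : curvePoly x y (Real.cos θ) (S θ) = 0) :
    (-(curvePt S θ)⁻¹ + curvePt S θ + 2 * x * curvePt S θ ^ 2 + 3 * y * curvePt S θ ^ 3).im =
      Real.sin θ * chordSlope x (Real.cos θ) (S θ) (S θ) / S θ ^ 2 := by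
  have hS' : (S θ : ℂ) ≠ 0 := by exact_mod_cast hS
  have hs := sq_sin_ofReal θ
  have e : -(curvePt S θ)⁻¹ + curvePt S θ + 2 * x * curvePt S θ ^ 2 + 3 * y * curvePt S θ ^ 3 =
      ((-(S θ) * Real.cos θ + Real.cos θ / S θ + 2 * x * (2 * Real.cos θ ^ 2 - 1) / S θ ^ 2
        + 3 * y * (4 * Real.cos θ ^ 3 - 3 * Real.cos θ) / S θ ^ 3 : ℝ) : ℂ) +
      ((Real.sin θ * (S θ + 1 / S θ + 4 * x * Real.cos θ / S θ ^ 2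
        + 3 * y * (4 * Real.cos θ ^ 2 - 1) / S θ ^ 3) : ℝ) : ℂ) * Complex.I := by
    rw [inv_curvePt hS, curvePt]
    push_cast
    rw [← Complex.ofReal_cos, ← Complex.ofReal_sin]
    set c : ℂ := ((Real.cos θ : ℝ) : ℂ) with hc
    set d : ℂ := ((Real.sin θ : ℝ) : ℂ) with hd
    field_simp
    have hI := Complex.I_sq
    have hI3 : Complex.I ^ 3 = -Complex.I := by linear_combination Complex.I * hI
    have hd3 : d ^ 3 = d * (1 - c ^ 2) := by linear_combination d * hs
    linear_combination (2 * x * S θ * d ^ 2 + 9 * y * c * d ^ 2) * hI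
      + 3 * y * d ^ 3 * hI3 - 3 * y * Complex.I * hd3 - (2 * x * S θ + 9 * y * c) * hs
  rw [e]
  simp only [Complex.add_im, Complex.ofReal_im, Complex.mul_im, Complex.ofReal_re,
      Complex.I_re, Complex.I_im]
  rw [curvePoly] at h0
  rw [chordSlope]
  field_simp
  linear_combination -3 * Real.sin θ * h0

theorem hasDerivAt_curvePt {S : ℝ → ℝ} {θ D : ℝ} (hS : S θ ≠ 0) (hD : HasDerivAt S D θ) :
    HasDerivAt (curvePt S) (curvePt S θ * ((-D / S θ : ℝ) + Complex.I)) θ := by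
  have hS' : (S θ : ℂ) ≠ 0 := by exact_mod_cast hS
  have h1 := ((Real.hasDerivAt_cos θ).ofReal_comp).add
    (((Real.hasDerivAt_sin θ).ofReal_comp).mul_const Complex.I)
  refine (h1.fun_div hD.ofReal_comp hS').congr_deriv ?_
  rw [curvePt]
  simp only [Pi.add_apply]
  push_cast
  field_simp
  linear_combination -(Complex.sin θ * S θ) * Complex.I_sq

/-- Since K is real along the curve, the imaginary part of W(-D/S + i) vanishes, where W = zK'(z).
This gives Re W = (D/S) Im W, and the real part becomes -Im W((D/S)² + 1), which has a definite
sign. -/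
theorem hasDerivAt_curveVal {x y : ℝ} {S : ℝ → ℝ} {θ D : ℝ} (hS : ∀ θ, S θ ≠ 0)
    (h0 : ∀ θ, curvePoly x y (Real.cos θ) (S θ) = 0) (hD : HasDerivAt S D θ) :
    HasDerivAt (curveVal x y S)
      (-(Real.sin θ * chordSlope x (Real.cos θ) (S θ) (S θ) / S θ ^ 2 * ((D / S θ) ^ 2 + 1))) θ := by
  have hz := hasDerivAt_curvePt (hS θ) hD
  have hne := curvePt_ne_zero (hS θ)
  set z := curvePt S θ with hzdef
  have hK : HasDerivAt (invTransform x y) (-(z ^ 2)⁻¹ + 1 + 2 * x * z + 3 * y * z ^ 2) z := by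
    have := (((hasDerivAt_inv hne).add (hasDerivAt_id' z)).add
      ((hasDerivAt_pow 2 z).const_mul (x : ℂ))).add ((hasDerivAt_pow 3 z).const_mul (y : ℂ))
    refine this.congr_deriv ?_
    norm_num
    ring
  have hcomp := hK.comp θ hz
  have hfun : (invTransform x y ∘ curvePt S) = fun θ => ((curveVal x y S θ : ℝ) : ℂ) := by
    funext θ
    exact invTransform_curvePt (hS θ) (h0 θ)
  rw [hfun] at hcomp
  set W := -z⁻¹ + z + 2 * x * z ^ 2 + 3 * y * z ^ 3 with hW
  have hWim : W.im = Real.sin θ * chordSlope x (Real.cos θ) (S θ) (S θ) / S θ ^ 2 :=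
    im_deriv_curvePt (hS θ) (h0 θ)
  have hder : (-(z ^ 2)⁻¹ + 1 + 2 * x * z + 3 * y * z ^ 2) *
      (z * (((-D / S θ : ℝ) : ℂ) + Complex.I)) = W * (((-D / S θ : ℝ) : ℂ) + Complex.I) := by
    rw [hW]; field_simp
  rw [hder] at hcomp
  have hre : HasDerivAt (curveVal x y S) (W * (((-D / S θ : ℝ) : ℂ) + Complex.I)).re θ :=
    Complex.reCLM.hasFDerivAt.comp_hasDerivAt θ hcomp
  have him : HasDerivAt (fun _ : ℝ => (0 : ℝ)) (W * (((-D / S θ : ℝ) : ℂ) + Complex.I)).im θ :=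
    Complex.imCLM.hasFDerivAt.comp_hasDerivAt θ hcomp
  have him0 := him.unique (hasDerivAt_const θ 0)
  simp only [Complex.mul_im, Complex.add_re, Complex.add_im, Complex.ofReal_re, Complex.ofReal_im,
    Complex.I_re, Complex.I_im] at him0
  refine hre.congr_deriv ?_
  simp only [Complex.mul_re, Complex.add_re, Complex.add_im, Complex.ofReal_re, Complex.ofReal_im,
    Complex.I_re, Complex.I_im]
  rw [← hWim]
  linear_combination (-D / S θ) * him0

open scoped Real in
/-- The integral of `Im (z ^ m dz)` over the upper half of the curve. -/
theorem integral_im_zpow_curvePt {S D : ℝ → ℝ} (hS : ∀ θ, S θ ≠ 0)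
    (hD : ∀ θ, HasDerivAt S (D θ) θ) (hDc : Continuous D) (m : ℤ) :
    ∫ θ in (0 : ℝ)..π, (curvePt S θ ^ m *
      (curvePt S θ * ((-D θ / S θ : ℝ) + Complex.I))).im = if m = -1 then π else 0 := by
  have hne : ∀ θ, curvePt S θ ≠ 0 := fun θ => curvePt_ne_zero (hS θ)
  have hSc : Continuous S := continuous_iff_continuousAt.2 fun θ => (hD θ).continuousAt
  have hz : ∀ θ, HasDerivAt (curvePt S) (curvePt S θ * ((-D θ / S θ : ℝ) + Complex.I)) θ :=
    fun θ => hasDerivAt_curvePt (hS θ) (hD θ)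
  have hzc : Continuous (curvePt S) := continuous_iff_continuousAt.2 fun θ => (hz θ).continuousAt
  split_ifs with hm
  · subst hm
    have : ∀ θ, (curvePt S θ ^ (-1 : ℤ) *
        (curvePt S θ * ((-D θ / S θ : ℝ) + Complex.I))).im = 1 := by
      intro θ
      rw [zpow_neg_one, inv_mul_cancel_left₀ (hne θ)]
      simp
    rw [intervalIntegral.integral_congr (fun θ _ => this θ)]
    simp
  · have hm1 : m + 1 ≠ 0 := fun h => hm (by omega)
    have hm1' : ((m + 1 : ℤ) : ℂ) ≠ 0 := by exact_mod_cast hm1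
    have hder : ∀ θ, HasDerivAt (fun θ => (curvePt S θ ^ (m + 1) / ((m + 1 : ℤ) : ℂ)).im)
        (curvePt S θ ^ m * (curvePt S θ * ((-D θ / S θ : ℝ) + Complex.I))).im θ := by
      intro θ
      have h1 := ((hasDerivAt_zpow (m + 1) (curvePt S θ) (Or.inl (hne θ))).comp θ (hz θ)).div_const
        ((m + 1 : ℤ) : ℂ)
      have h2 := Complex.imCLM.hasFDerivAt.comp_hasDerivAt θ h1
      refine h2.congr_deriv ?_
      rw [add_sub_cancel_right, mul_assoc, mul_div_cancel_left₀ _ hm1']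
      rfl
    have hcont : Continuous fun θ => (curvePt S θ ^ m *
        (curvePt S θ * ((-D θ / S θ : ℝ) + Complex.I))).im := by
      have h1 : Continuous fun θ => curvePt S θ ^ m := hzc.zpow₀ m fun θ => Or.inl (hne θ)
      have h2 : Continuous fun θ => -D θ / S θ := hDc.neg.div hSc hS
      have h3 : Continuous fun θ => ((-D θ / S θ : ℝ) : ℂ) := Complex.continuous_ofReal.comp h2
      exact Complex.continuous_im.comp (h1.mul (hzc.mul (h3.add continuous_const)))
    rw [intervalIntegral.integral_eq_sub_of_hasDerivAt (fun θ _ => hder θ)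
      (hcont.intervalIntegrable 0 π)]
    -- The curve ends on the real axis, so the primitive of zᵐ has zero imaginary part at both ends.
    have hreal : ∀ θ, Real.sin θ = 0 →
        (curvePt S θ ^ (m + 1) / ((m + 1 : ℤ) : ℂ)).im = 0 := by
      intro θ hθ
      have : curvePt S θ ^ (m + 1) / ((m + 1 : ℤ) : ℂ) =
          (((Real.cos θ / S θ) ^ (m + 1) / ((m + 1 : ℤ) : ℝ) : ℝ) : ℂ) := by
        rw [curvePt, hθ]
        push_cast
        simp
      rw [this, Complex.ofReal_im]
    rw [hreal π Real.sin_pi, hreal 0 Real.sin_zero, sub_zero]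

theorem cumFun_eq_sum (x y : ℝ) (n : ℕ) (z : ℂ) : cumFun x y z ^ n =
    ∑ k ∈ Finset.range ((cumPoly x y ^ n).natDegree + 1),
      (((cumPoly x y ^ n).coeff k : ℝ) : ℂ) * z ^ k := by
  have h1 : Polynomial.aeval z (cumPoly x y ^ n) = cumFun x y z ^ n := by
    rw [map_pow, cumPoly, cumFun]
    simp
  rw [← h1, Polynomial.aeval_eq_sum_range]
  exact Finset.sum_congr rfl fun k _ => by rw [Algebra.smul_def]; rfl

open scoped Real in
-- On the curve u = Φ(z)/z; in the expansion of uⁿ⁺¹ only the power z⁻¹, with coefficient [zⁿ] Φⁿ⁺¹,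
-- contributes.
theorem integral_curveVal_pow {x y : ℝ} {S D : ℝ → ℝ} (hS : ∀ θ, S θ ≠ 0)
    (h0 : ∀ θ, curvePoly x y (Real.cos θ) (S θ) = 0)
    (hD : ∀ θ, HasDerivAt S (D θ) θ) (hDc : Continuous D) (n : ℕ) :
    ∫ θ in (0 : ℝ)..π, curveVal x y S θ ^ (n + 1) *
      (curvePt S θ * ((-D θ / S θ : ℝ) + Complex.I)).im =
      π * (cumPoly x y ^ (n + 1)).coeff n := by
  have hne : ∀ θ, curvePt S θ ≠ 0 := fun θ => curvePt_ne_zero (hS θ)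
  have hSc : Continuous S := continuous_iff_continuousAt.2 fun θ => (hD θ).continuousAt
  have hz : ∀ θ, HasDerivAt (curvePt S) (curvePt S θ * ((-D θ / S θ : ℝ) + Complex.I)) θ :=
    fun θ => hasDerivAt_curvePt (hS θ) (hD θ)
  have hzc : Continuous (curvePt S) := continuous_iff_continuousAt.2 fun θ => (hz θ).continuousAt
  set P := cumPoly x y ^ (n + 1) with hP
  have hexp : ∀ θ, curveVal x y S θ ^ (n + 1) *
      (curvePt S θ * ((-D θ / S θ : ℝ) + Complex.I)).im =
      ∑ k ∈ Finset.range (P.natDegree + 1), P.coeff k *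
        (curvePt S θ ^ ((k : ℤ) - (n + 1)) *
          (curvePt S θ * ((-D θ / S θ : ℝ) + Complex.I))).im := by
    intro θ
    have hKz := invTransform_curvePt (hS θ) (h0 θ)
    set z := curvePt S θ
    have hzne : z ≠ 0 := hne θ
    have h1 : ((curveVal x y S θ : ℝ) : ℂ) = cumFun x y z / z := by
      rw [← hKz, invTransform, cumFun]
      field_simp
    have h2 : ((curveVal x y S θ ^ (n + 1) : ℝ) : ℂ) =
        ∑ k ∈ Finset.range (P.natDegree + 1), ((P.coeff k : ℝ) : ℂ) * z ^ ((k : ℤ) - (n + 1)) := by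
      rw [Complex.ofReal_pow, h1, div_pow, cumFun_eq_sum, Finset.sum_div]
      refine Finset.sum_congr rfl fun k _ => ?_
      rw [zpow_sub₀ hzne, mul_div_assoc]
      norm_cast
    rw [← Complex.im_ofReal_mul, h2, Finset.sum_mul, Complex.im_sum]
    exact Finset.sum_congr rfl fun k _ => by rw [mul_assoc, Complex.im_ofReal_mul]
  simp only [hexp]
  rw [intervalIntegral.integral_finsetSum]
  · simp only [intervalIntegral.integral_const_mul, integral_im_zpow_curvePt hS hD hDc]
    have : ∀ k : ℕ, ((k : ℤ) - (n + 1) = -1) ↔ k = n := fun k => by omega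
    simp only [this, mul_ite, mul_zero]
    rw [Finset.sum_ite_eq']
    split_ifs with h
    · ring
    · rw [Polynomial.coeff_eq_zero_of_natDegree_lt (by rw [Finset.mem_range] at h; omega), mul_zero]
  · intro k _
    refine Continuous.intervalIntegrable ?_ 0 π
    have h1 : Continuous fun θ => curvePt S θ ^ ((k : ℤ) - (n + 1)) :=
      hzc.zpow₀ _ fun θ => Or.inl (hne θ)
    have h2 : Continuous fun θ => -D θ / S θ := hDc.neg.div hSc hS
    have h3 : Continuous fun θ => ((-D θ / S θ : ℝ) : ℂ) := Complex.continuous_ofReal.comp h2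
    exact continuous_const.mul
      (Complex.continuous_im.comp (h1.mul (hzc.mul (h3.add continuous_const))))

open scoped Real in
theorem isRealizable_of_strict {x y s₀ : ℝ} (hs₀ : 0 < s₀) (h6 : 1 / 6 ≤ s₀ ^ 2)
    (hneg : ∀ c : ℝ, |c| ≤ 1 → curvePoly x y c s₀ < 0) : IsRealizable (cumulantSeq x y) := by
  obtain ⟨M, hM⟩ := exists_curve_root hs₀ hneg
  choose S hS using fun θ => hM (Real.cos θ) (Real.abs_cos_le_one θ)
  set A : ℝ → ℝ := fun θ => chordSlope x (Real.cos θ) (S θ) (S θ) with hA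
  set D : ℝ → ℝ := fun θ => Real.sin θ * (-2 * x * S θ - 8 * y * Real.cos θ) / A θ with hDdef
  have hD : ∀ θ, HasDerivAt S (D θ) θ := hasDerivAt_curve_root hs₀ h6 hneg hS
  have hSpos : ∀ θ, 0 < S θ := fun θ => hs₀.trans (hS θ).1
  have hSne : ∀ θ, S θ ≠ 0 := fun θ => (hSpos θ).ne'
  have h0 : ∀ θ, curvePoly x y (Real.cos θ) (S θ) = 0 := fun θ => (hS θ).2.2
  have hApos : ∀ θ, 0 < A θ := fun θ => by
    have := chordSlope_pos hs₀ h6 (hneg _ (Real.abs_cos_le_one θ)) (hS θ).1 (hS θ).1.le (h0 θ)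
    exact this.1.trans_le this.2
  have hSc : Continuous S := continuous_iff_continuousAt.2 fun θ => (hD θ).continuousAt
  have hAc : Continuous A := by
    simp only [hA]; unfold chordSlope; fun_prop
  have hDc : Continuous D := by
    refine Continuous.div ?_ hAc fun θ => (hApos θ).ne'
    fun_prop
  set B : ℝ → ℝ := fun θ => Real.sin θ * A θ / S θ ^ 2 * ((D θ / S θ) ^ 2 + 1) with hB
  have hBc : Continuous B := by
    have h1 : Continuous fun θ => Real.sin θ * A θ / S θ ^ 2 :=
      (Real.continuous_sin.mul hAc).div (hSc.pow 2) fun θ => pow_ne_zero 2 (hSne θ)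
    exact h1.mul (((hDc.div hSc hSne).pow 2).add continuous_const)
  set u := curveVal x y S with hu
  have hu' : ∀ θ, HasDerivAt u (-B θ) θ := fun θ => hasDerivAt_curveVal hSne h0 (hD θ)
  have huc : Continuous u := continuous_iff_continuousAt.2 fun θ => (hu' θ).continuousAt
  set v : ℝ → ℝ := fun θ => Real.sin θ / S θ with hv
  have hvc : Continuous v := Real.continuous_sin.div hSc hSne
  set v' : ℝ → ℝ := fun θ => (curvePt S θ * ((-D θ / S θ : ℝ) + Complex.I)).im with hv'
  have hvder : ∀ θ, HasDerivAt v (v' θ) θ := by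
    intro θ
    have h1 := Complex.imCLM.hasFDerivAt.comp_hasDerivAt θ (hasDerivAt_curvePt (hSne θ) (hD θ))
    have h2 : (Complex.imCLM ∘ curvePt S) = v := by
      funext θ
      simp only [Function.comp, Complex.imCLM_apply, curvePt, hv, Complex.div_ofReal_im]
      rw [Complex.add_im, Complex.ofReal_im, Complex.im_ofReal_mul, Complex.I_im, mul_one, zero_add]
    rw [h2] at h1
    exact h1
  have hv'c : Continuous v' := by
    have hzc : Continuous (curvePt S) := continuous_iff_continuousAt.2 fun θ =>
      (hasDerivAt_curvePt (hSne θ) (hD θ)).continuousAt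
    have h2 : Continuous fun θ => -D θ / S θ := hDc.neg.div hSc hSne
    have h3 : Continuous fun θ => ((-D θ / S θ : ℝ) : ℂ) := Complex.continuous_ofReal.comp h2
    exact Complex.continuous_im.comp (hzc.mul (h3.add continuous_const))
  have hmom : ∀ n : ℕ, ∫ θ in (0 : ℝ)..π, (B θ * v θ / π) * u θ ^ n =
      ncMoment (cumulantSeq x y) n := by
    -- Integrate the derivative of uⁿ⁺¹v over [0, π]: v = Im z vanishes at both ends, and u' = -B.
    intro n
    have hprod : ∀ θ, HasDerivAt (fun θ => u θ ^ (n + 1) * v θ)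
        (-(((n : ℝ) + 1) * π * ((B θ * v θ / π) * u θ ^ n)) + u θ ^ (n + 1) * v' θ) θ := by
      intro θ
      refine (((hu' θ).fun_pow (n + 1)).fun_mul (hvder θ)).congr_deriv ?_
      rw [Nat.add_sub_cancel]
      push_cast
      have := Real.pi_ne_zero
      field_simp
    have hc1 : Continuous fun θ => -(((n : ℝ) + 1) * π * ((B θ * v θ / π) * u θ ^ n)) :=
      (continuous_const.mul (((hBc.mul hvc).div_const π).mul (huc.pow n))).neg
    have hc2 : Continuous fun θ => u θ ^ (n + 1) * v' θ := (huc.pow (n + 1)).mul hv'c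
    have hftc := intervalIntegral.integral_eq_sub_of_hasDerivAt (a := 0) (b := π)
      (fun θ _ => hprod θ) ((hc1.add hc2).intervalIntegrable 0 π)
    rw [intervalIntegral.integral_add (hc1.intervalIntegrable 0 π) (hc2.intervalIntegrable 0 π),
      intervalIntegral.integral_neg, intervalIntegral.integral_const_mul,
      integral_curveVal_pow hSne h0 hD hDc n, ← ncMoment_cumulantSeq] at hftc
    simp only [hv, Real.sin_pi, Real.sin_zero, zero_div, mul_zero, sub_zero] at hftc
    have hn : ((n : ℝ) + 1) * π ≠ 0 := by positivity
    refine mul_left_cancel₀ hn ?_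
    linear_combination -hftc
  obtain ⟨μ, hμ, hint, hval⟩ := exists_measure_of_density (w := fun θ => B θ * v θ / π) huc
    ((hBc.mul hvc).div_const π) (fun θ hθ => by
      have hsin : 0 ≤ Real.sin θ := Real.sin_nonneg_of_mem_Icc ⟨hθ.1.le, hθ.2⟩
      have := (hApos θ).le
      have := (hSpos θ).le
      simp only [hB, hv]
      positivity) (ncMoment_zero _) hmom
  exact ⟨μ, hμ, hint, fun n _ => hval n⟩

/-! ### Closedness of the realizable set and the boundary of the region -/

theorem continuous_ncMoment_cumulantSeq (n : ℕ) :
    Continuous fun p : ℝ × ℝ => ncMoment (cumulantSeq p.1 p.2) n := by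
  have h : ∀ k, Continuous fun p : ℝ × ℝ => cumulantSeq p.1 p.2 k := by
    intro k
    match k with
    | 0 => exact continuous_const
    | 1 => exact continuous_const
    | 2 => exact continuous_const
    | 3 => exact continuous_fst
    | 4 => exact continuous_snd
    | (k + 5) => exact continuous_const
  unfold ncMoment
  exact continuous_finsetSum _ fun π _ => continuous_finsetProd _ fun B _ => h _

open Filter Topology BoundedContinuousFunction in
/-- The set of realizable pairs is closed under limits of sequences. -/
theorem isRealizable_of_tendsto {p : ℕ → ℝ × ℝ} {x y : ℝ} (hp : Tendsto p atTop (𝓝 (x, y)))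
    (h : ∀ k, IsRealizable (cumulantSeq (p k).1 (p k).2)) : IsRealizable (cumulantSeq x y) := by
  choose μ hμ hκ using h
  have hcont : Tendsto (fun k => 2 + |(p k).1| + |(p k).2|) atTop (𝓝 (2 + |x| + |y|)) := by
    have : Continuous fun q : ℝ × ℝ => 2 + |q.1| + |q.2| := by fun_prop
    exact (this.tendsto (x, y)).comp hp
  set R := 2 + |x| + |y| + 1 with hR
  have hR0 : 0 < R := by positivity
  have hev : ∀ᶠ k in atTop, ∀ᵐ u ∂μ k, |u| ≤ R := by
    filter_upwards [hcont.eventually_le_const (by linarith : 2 + |x| + |y| < R)] with k hk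
    filter_upwards [(hκ k).ae_abs_le] with u hu
    exact hu.trans hk
  set P : ℕ → ProbabilityMeasure ℝ := fun k => ⟨μ k, hμ k⟩ with hP
  have hset : ∀ ν : ProbabilityMeasure ℝ, (∀ᵐ u ∂(ν : Measure ℝ), |u| ≤ R) ↔
      ∀ _ : ℕ, ν (Set.Icc (-R) R)ᶜ ≤ 0 := by
    intro ν
    rw [forall_const, nonpos_iff_eq_zero, ProbabilityMeasure.null_iff_toMeasure_null, ae_iff]
    have : {u : ℝ | ¬|u| ≤ R} = (Set.Icc (-R) R)ᶜ := by
      ext u; simp [abs_le]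
    rw [this]
  -- Prokhorov compactness of the probability measures carried by [-R, R]; a limit along an
  -- ultrafilter replaces a convergent subsequence.
  have hK := isCompact_setOfPred_probabilityMeasure_mass_eq_compl_isCompact_le (E := ℝ)
    (u := fun _ => 0) (K := fun _ => Set.Icc (-R) R) tendsto_const_nhds
    (fun _ => isCompact_Icc) (Or.inr monotone_const)
  have hU : (hyperfilter ℕ : Filter ℕ) ≤ atTop := by
    rw [← Nat.cofinite_eq_atTop]; exact hyperfilter_le_cofinite
  obtain ⟨ν, hν, hlim⟩ := hK.ultrafilter_le_nhds' ((hyperfilter ℕ).map P) (by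
    refine Ultrafilter.mem_map.2 (hU ?_)
    filter_upwards [hev] with k hk
    exact (hset (P k)).1 hk)
  have hlim' : Tendsto P (hyperfilter ℕ : Filter ℕ) (𝓝 ν) := hlim
  have hνsupp : ∀ᵐ u ∂(ν : Measure ℝ), |u| ≤ R := (hset ν).2 hν
  have hclamp : ∀ u : ℝ, |u| ≤ R → max (-R) (min u R) = u := fun u hu => by
    rw [min_eq_left (abs_le.1 hu).2, max_eq_right (abs_le.1 hu).1]
  -- Weak convergence tests only bounded functions, so the powers are truncated outside [-R, R],
  -- where none of the measures concerned has mass.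
  let φ : ℕ → ℝ →ᵇ ℝ := fun n => BoundedContinuousFunction.ofNormedAddCommGroup
    (fun u : ℝ => max (-R) (min u R) ^ n) (by fun_prop) (R ^ n) fun u => by
      rw [norm_pow, Real.norm_eq_abs]
      refine pow_le_pow_left₀ (abs_nonneg _) (abs_le.2 ⟨le_max_left _ _, ?_⟩) n
      exact max_le (by linarith) (min_le_right _ _)
  have hφ : ∀ (ρ : Measure ℝ), (∀ᵐ u ∂ρ, |u| ≤ R) → ∀ n, (fun u => φ n u) =ᵐ[ρ] fun u => u ^ n := by
    intro ρ hρ n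
    filter_upwards [hρ] with u hu
    change max (-R) (min u R) ^ n = u ^ n
    rw [hclamp u hu]
  refine ⟨ν, ν.2, fun n => ?_, fun n _ => ?_⟩
  · exact ((φ n).integrable (ν : Measure ℝ)).congr (hφ _ hνsupp n)
  · have h1 := (ProbabilityMeasure.tendsto_iff_forall_integral_tendsto.1 hlim') (φ n)
    have h2 : Tendsto (fun k => ncMoment (cumulantSeq (p k).1 (p k).2) n)
        (hyperfilter ℕ : Filter ℕ) (𝓝 (ncMoment (cumulantSeq x y) n)) :=
      (((continuous_ncMoment_cumulantSeq n).tendsto (x, y)).comp hp).mono_left hU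
    have h3 : (fun k => ∫ u, φ n u ∂(P k : Measure ℝ)) =ᶠ[(hyperfilter ℕ : Filter ℕ)]
        fun k => ncMoment (cumulantSeq (p k).1 (p k).2) n := by
      refine hU ?_
      filter_upwards [hev] with k hk
      rw [← (hκ k).integral_pow n]
      exact integral_congr_ae (hφ _ hk n)
    rw [← integral_congr_ae (hφ _ hνsupp n)]
    exact tendsto_nhds_unique (h1.congr' h3) h2

open Filter Topology in
theorem isRealizable_of_mem_regionD {x y : ℝ} (h : (x, y) ∈ regionD) :
    IsRealizable (cumulantSeq x y) := by
  obtain ⟨s, hs0, hs6, hs1, hs⟩ := exists_curvePoly_nonpos h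
  set t : ℕ → ℝ := fun k => 1 - 1 / ((k : ℝ) + 1) with ht
  have htlim : Tendsto t atTop (𝓝 1) := by
    have := (tendsto_one_div_add_atTop_nhds_zero_nat (𝕜 := ℝ)).const_sub 1
    rwa [sub_zero] at this
  refine isRealizable_of_tendsto (p := fun k => (t k * x, t k * y)) ?_ fun k => ?_
  · have := (htlim.mul_const x).prodMk_nhds (htlim.mul_const y)
    simpa using this
  · refine isRealizable_of_strict hs0 hs6 fun c hc => ?_
    have h1 : (0 : ℝ) < 1 / ((k : ℝ) + 1) := by positivity
    have h2 : 1 / ((k : ℝ) + 1) ≤ 1 := by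
      rw [div_le_one (by positivity)]
      have : (0 : ℝ) ≤ k := Nat.cast_nonneg k
      linarith
    have h3 : 0 ≤ t k := by simp only [ht]; linarith
    -- `curvePoly` is affine in (x, y), and at (0, 0) it equals s²(s² - 1) < 0, so shrinking makes
    -- the inequality strict.
    have e : curvePoly (t k * x) (t k * y) c s =
        t k * curvePoly x y c s + 1 / ((k : ℝ) + 1) * (s ^ 2 * (s ^ 2 - 1)) := by
      simp only [curvePoly, ht]; ring
    have h4 : s ^ 2 * (s ^ 2 - 1) < 0 := mul_neg_of_pos_of_neg (by positivity) (by linarith)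
    have h5 := mul_nonpos_of_nonneg_of_nonpos h3 (hs c hc)
    have h6 := mul_neg_of_pos_of_neg h1 h4
    simp only
    rw [e]
    linarith

theorem mem_regionD_zero {x : ℝ} : (x, (0 : ℝ)) ∈ regionD ↔ |x| ≤ 1 / (3 * √3) := by
  have hf : f₁ 0 = 1 / (3 * √3) := by
    have h3 : √(3 : ℝ) ≠ 0 := by positivity
    have h2 : √(2 : ℝ) ≠ 0 := by positivity
    have h6 : √(6 : ℝ) = √2 * √3 := by rw [← Real.sqrt_mul (by norm_num)]; norm_num
    rw [f₁, mul_zero, sub_zero, Real.sqrt_one, h6, show (1 : ℝ) + 1 = 2 by norm_num]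
    field_simp
    norm_num
  rw [← hf]
  constructor
  · rintro (h | ⟨-, h, -⟩)
    · exact h.1
    · norm_num at h
  · intro h
    exact Or.inl ⟨h, by norm_num, by norm_num⟩

theorem corollary2 :
    (∀ x y : ℝ, IsRealizable (cumulantSeq x y) ↔ (x, y) ∈ regionD) ∧
      ∀ x : ℝ, IsRealizable (cumulantSeq x 0) ↔ |x| ≤ 1 / (3 * √3) := by
  have h : ∀ x y : ℝ, IsRealizable (cumulantSeq x y) ↔ (x, y) ∈ regionD := fun _ _ =>
    ⟨IsRealizable.mem_regionD, isRealizable_of_mem_regionD⟩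
  exact ⟨h, fun x => (h x 0).trans mem_regionD_zero⟩
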